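/- **Setting.** A *pseudogroup of transformations* of a space $\Omega$ is a family of homeomorphisms between open subsets of $\Omega$ that contains the identity and is closed under composition, inversion, restriction to open sets, and gluing of finitely many members whose union is again a homeomorphism between open sets. A *compact generating system* of a pseudogroup $\Gamma$ consists of a relatively compact open set $Y\subset\Omega$ meeting all $\Gamma$-orbits and a finite set $\Lambda$ of elements of $\Gamma$ with domain and range in $Y$ that generates the reduced pseudogroup $\Gamma|_Y$, such that each $\lambda\in\Lambda$ is the restriction of some $\bar\lambda\in\Gamma$ with $\overline{\operatorname{dom}\lambda}\subset\operatorname{dom}\bar\lambda$. For $\epsilon>0$, $\Gamma$ is *$\epsilon$-expansive* (with respect to this generating system) if for all $w\neq w'$ in $Y$ with $d(w,w')<\epsilon$ there is a composition $\gamma$ of elements of $\Lambda\cup\Lambda^{-1}$ with $w,w'\in\operatorname{dom}\gamma$ and $d(\gamma(w),\gamma(w'))\ge\epsilon$. Let $\mathcal F_n$ be the Cayley graph of the free group $F_n$ on $a_1,\dots,a_n$, in which the edge from $g$ to $ga_i$ is directed and labelled $a_i$. Let $X_n$ be the set of non-compact, connected and simply connected subgraphs $T$ of $\mathcal F_n$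 that contain the identity $e$, with the metric $d(T,T')=e^{-r}$, where $r$ is the greatest natural number for which the balls $B_T(e,r)$ and $B_{T'}(e,r)$ are isomorphic as pointed directed labelled graphs (and $d(T,T')=0$ if they are isomorphic for all $r$). For $g\in F_n$ and $T\in X_n$ with $g\in V(T)$, let $T\cdot g$ be the tree $T'\in X_n$ for which $(T',e)$ is isomorphic to $(T,g)$. Let $\mathfrak G_n$ be the pseudogroup on $X_n$ generated by the local homeomorphisms $\tau_g:T\mapsto T\cdot g$, $g\in F_n$. **Theorem.** Let $\Omega$ be a $0$-dimensional compact metric space, and let $\Gamma$ be a pseudogroup on $\Omega$ that admits a compact generating system with respect to which it is $\epsilon$-expansive for some $\epsilon>0$. Then for every large enough $n$ there is an embedding $\Phi:\Omega\to X_n$ that is equivariant with respect to $\Gamma$ and $\mathfrak G_n$: the image $\Phi(\Omega)$ is a closed $\mathfrak G_n$-invariant subset of $X_n$, and $\Phi$ is a conjugacy between $(\Omega,\Gamma)$ and $\Phi(\Omega)$ with the pseudogroup induced by $\mathfrak G_n$; that is, for each $\tau\in\mathfrak G_n$ there is $\gamma\in\Gamma$ with $\operatorname{dom}\gamma=\Phi^{-1}(\operatorname{dom}\tau)$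 and $\Phi\circ\gamma=\tau\circ\Phi$ on $\operatorname{dom}\gamma$, and $\Gamma$ is generated by the elements $\gamma$ obtained in this way. -/

import Mathlib

/-! ## Pseudogroups of transformations -/

/-- A pseudogroup of transformations of a space `X`: a family of homeomorphisms between open
subsets of `X` that contains the identity and is closed under composition, inversion, restriction
to open sets, and extension (gluing finitely many members to form another homeomorphism between
open sets; gluing two at a time suffices). -/
structure TransPseudogroup (X : Type*) [TopologicalSpace X] where
  carrier : Set (OpenPartialHomeomorph X X)
  refl_mem : OpenPartialHomeomorph.refl X ∈ carrier
  trans_mem : ∀ {e f : OpenPartialHomeomorph X X},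
    e ∈ carrier → f ∈ carrier → e.trans f ∈ carrier
  symm_mem : ∀ {e : OpenPartialHomeomorph X X}, e ∈ carrier → e.symm ∈ carrier
  restr_mem : ∀ {e : OpenPartialHomeomorph X X} {s : Set X} (hs : IsOpen s),
    e ∈ carrier → e.restrOpen s hs ∈ carrier
  glue_mem : ∀ {e e₁ e₂ : OpenPartialHomeomorph X X}, e₁ ∈ carrier → e₂ ∈ carrier →
    e.source = e₁.source ∪ e₂.source → Set.EqOn e e₁ e₁.source → Set.EqOn e e₂ e₂.source →
    e ∈ carrier

namespace TransPseudogroup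

variable {X : Type*} [TopologicalSpace X]

/-- The pseudogroup generated by a family `S` of homeomorphisms between open sets: the smallest
pseudogroup that contains `S`. -/
def generate (S : Set (OpenPartialHomeomorph X X)) : TransPseudogroup X where
  carrier := {e | ∀ G : TransPseudogroup X, S ⊆ G.carrier → e ∈ G.carrier}
  refl_mem := fun G _ => G.refl_mem
  trans_mem := fun he hf G hG => G.trans_mem (he G hG) (hf G hG)
  symm_mem := fun he G hG => G.symm_mem (he G hG)
  restr_mem := fun hs he G hG => G.restr_mem hs (he G hG)
  glue_mem := fun h₁ h₂ hs he₁ he₂ G hG => G.glue_mem (h₁ G hG) (h₂ G hG) hs he₁ he₂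

/-- The reduced pseudogroup `Γ|_Y` on an open set `Y`: the members of `Γ` whose domain and range
are contained in `Y`. -/
def reduced (Γ : TransPseudogroup X) (Y : Set X) : Set (OpenPartialHomeomorph X X) :=
  {e | e ∈ Γ.carrier ∧ e.source ⊆ Y ∧ e.target ⊆ Y}

/-- `Y` meets all orbits of `Γ`. -/
def MeetsAllOrbits (Γ : TransPseudogroup X) (Y : Set X) : Prop :=
  ∀ x : X, ∃ γ ∈ Γ.carrier, x ∈ γ.source ∧ γ x ∈ Y

/-- `Z` is invariant under `Γ`: it contains the whole orbit of each of its points. -/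
def IsInvariant (Γ : TransPseudogroup X) (Z : Set X) : Prop :=
  ∀ γ ∈ Γ.carrier, ∀ x ∈ Z, x ∈ γ.source → γ x ∈ Z

/-- `Λ` is a compact generating system of `Γ` on `Y`: `Y` is a relatively compact open set that
meets all orbits, and the reduced pseudogroup `Γ|_Y` is generated by the finite set `Λ`, each
element of which is the restriction of some `γ ∈ Γ` whose domain contains the closure of its
domain. (The elements of `Λ` live on `Y`, so `(generate Λ).reduced Y` is the pseudogroup on `Y`
generated by `Λ`.) -/
structure IsCompactGeneratingSystem (Γ : TransPseudogroup X) (Y : Set X)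
    (Λ : Set (OpenPartialHomeomorph X X)) : Prop where
  isOpen : IsOpen Y
  isCompact_closure : IsCompact (closure Y)
  meets : Γ.MeetsAllOrbits Y
  finite : Λ.Finite
  subset : Λ ⊆ Γ.reduced Y
  generates : (generate Λ).reduced Y = Γ.reduced Y
  extends_closure : ∀ l ∈ Λ, ∃ γ ∈ Γ.carrier, closure l.source ⊆ γ.source ∧ Set.EqOn l γ l.source

/-- The compositions of finitely many elements of `Λ` and of inverses of elements of `Λ`, each
with its natural (maximal) domain; no gluing is performed. -/
inductive IsWord (Λ : Set (OpenPartialHomeomorph X X)) : OpenPartialHomeomorph X X → Prop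
  | refl : IsWord Λ (OpenPartialHomeomorph.refl X)
  | append {w l : OpenPartialHomeomorph X X} : IsWord Λ w → l ∈ Λ → IsWord Λ (w.trans l)
  | append_symm {w l : OpenPartialHomeomorph X X} :
      IsWord Λ w → l ∈ Λ → IsWord Λ (w.trans l.symm)

/-- `ε`-expansiveness of the transformations of `Y` generated by `Λ`: any two distinct points
`w, w'` of `Y` with `d(w, w') < ε` lie in the domain of a common composition `γ` of elements of
`Λ` and their inverses such that `d(γ(w), γ(w')) ≥ ε`. -/
def IsExpansiveAlong {Ω : Type*} [MetricSpace Ω] (ε : ℝ) (Y : Set Ω)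
    (Λ : Set (OpenPartialHomeomorph Ω Ω)) : Prop :=
  ∀ w ∈ Y, ∀ w' ∈ Y, w ≠ w' → dist w w' < ε →
    ∃ γ, IsWord Λ γ ∧ w ∈ γ.source ∧ w' ∈ γ.source ∧ ε ≤ dist (γ w) (γ w')

/-- `γ` is the transformation of `Ω` that corresponds through `Φ` to the restriction of `τ` to the
image of `Φ`: their domains correspond, and `Φ ∘ γ = τ ∘ Φ` there. -/
def Intertwines {Ω : Type*} [TopologicalSpace Ω] (Φ : Ω → X) (γ : OpenPartialHomeomorph Ω Ω)
    (τ : OpenPartialHomeomorph X X) : Prop :=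
  γ.source = Φ ⁻¹' τ.source ∧ ∀ x ∈ γ.source, Φ (γ x) = τ (Φ x)

/-- `Φ` is an embedding of `(Ω, Γ)` in `(X, G)`, equivariant for the two pseudogroups, that is, a
conjugacy of `(Ω, Γ)` with the action of `G` on the closed `G`-invariant set `Φ(Ω)`: the
restriction to `Φ(Ω)` of each member of `G` corresponds to a member of `Γ`, and the pseudogroup
`Γ` is generated by these members. -/
structure IsEquivariantEmbedding {Ω : Type*} [TopologicalSpace Ω] (Γ : TransPseudogroup Ω)
    (G : TransPseudogroup X) (Φ : Ω → X) : Prop where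
  isClosedEmbedding : Topology.IsClosedEmbedding Φ
  isInvariant : G.IsInvariant (Set.range Φ)
  exists_intertwines : ∀ τ ∈ G.carrier, ∃ γ ∈ Γ.carrier, Intertwines Φ γ τ
  eq_generate : Γ = generate {γ | ∃ τ ∈ G.carrier, Intertwines Φ γ τ}

end TransPseudogroup

/-! ## The space of pointed trees -/

namespace PointedTrees

/-- The Cayley graph of the free group `F_n` with respect to its free generators: `g` and `h` are
joined by an edge if and only if `h = g aᵢ` or `g = h aᵢ` for some `i`. -/
abbrev cayleyGraph (n : ℕ) : SimpleGraph (FreeGroup (Fin n)) :=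
  SimpleGraph.mulCayley (Set.range FreeGroup.of)

/-- The set `X_n` of all non-compact (equivalently, infinite), connected and simply connected
subgraphs of the Cayley graph of `F_n` that contain the identity. -/
@[ext]
structure TreeSpace (n : ℕ) where
  graph : (cayleyGraph n).Subgraph
  one_mem : 1 ∈ graph.verts
  connected : graph.Connected
  acyclic : graph.coe.IsAcyclic
  infinite : graph.verts.Infinite

variable {n : ℕ}

/-- `A` has an edge with label `aᵢ` directed from `u` to `v`. -/
def HasEdge (A : (cayleyGraph n).Subgraph) (i : Fin n) (u v : FreeGroup (Fin n)) : Prop :=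
  A.Adj u v ∧ v = u * FreeGroup.of i

/-- The pointed subgraphs `(A, a)` and `(B, b)` are isomorphic: there is an isomorphism of graphs
that maps `a` to `b` and preserves the (directed) labels of the edges. Every edge of the Cayley
graph carries a label, so that adjacency is preserved as well. -/
def Isomorphic (A : (cayleyGraph n).Subgraph) (a : A.verts)
    (B : (cayleyGraph n).Subgraph) (b : B.verts) : Prop :=
  ∃ φ : A.verts ≃ B.verts, φ a = b ∧
    ∀ (i : Fin n) (u v : A.verts), HasEdge A i u v ↔ HasEdge B i (φ u) (φ v)

/-- The closed ball `B_T(e, r)` of radius `r` in `T`, with respect to the length metric of `T`. -/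
def ball (T : TreeSpace n) (r : ℕ) : (cayleyGraph n).Subgraph :=
  T.graph.induce {v | ∃ h : v ∈ T.graph.verts, T.graph.coe.dist ⟨1, T.one_mem⟩ ⟨v, h⟩ ≤ r}

theorem one_mem_ball (T : TreeSpace n) (r : ℕ) : 1 ∈ (ball T r).verts :=
  ⟨T.one_mem, by simp⟩

/-- The balls of radius `r` about the base points of `T` and `T'` are isomorphic. -/
def BallsIsomorphic (T T' : TreeSpace n) (r : ℕ) : Prop :=
  Isomorphic (ball T r) ⟨1, one_mem_ball T r⟩ (ball T' r) ⟨1, one_mem_ball T' r⟩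

/-- The box metric `d(T, T') = e^{-r}`, where `r` is the greatest natural number for which the
balls of radius `r` are isomorphic, and `d(T, T') = 0` if they are isomorphic for all `r`. -/
noncomputable def boxDist (T T' : TreeSpace n) : ℝ :=
  sInf {d : ℝ | ∃ r : ℕ, BallsIsomorphic T T' r ∧ d = Real.exp (-(r : ℝ))}

theorem exists_hasEdge {A : (cayleyGraph n).Subgraph} {u v : FreeGroup (Fin n)} (h : A.Adj u v) :
    ∃ i, HasEdge A i u v ∨ HasEdge A i v u := by
  have h' := A.adj_sub h
  rw [SimpleGraph.mulCayley_adj'] at h'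
  obtain ⟨-, -, ⟨i, rfl⟩, h1 | h1⟩ := h'
  · exact ⟨i, Or.inl ⟨h, h1.symm⟩⟩
  · exact ⟨i, Or.inr ⟨h.symm, h1⟩⟩

theorem coe_eq_of_isomorphic {A B : (cayleyGraph n).Subgraph} {hA : 1 ∈ A.verts}
    {hB : 1 ∈ B.verts} {φ : A.verts ≃ B.verts} (h1 : φ ⟨1, hA⟩ = ⟨1, hB⟩)
    (hφ : ∀ (i : Fin n) (u v : A.verts), HasEdge A i u v ↔ HasEdge B i (φ u) (φ v))
    (v : A.verts) (hv : A.coe.Reachable v ⟨1, hA⟩) : (φ v : FreeGroup (Fin n)) = v := by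
  obtain ⟨p⟩ := hv
  generalize hw : (⟨1, hA⟩ : A.verts) = w at p
  induction p with
  | nil => subst hw; rw [h1]
  | @cons u x y h q ih =>
    have ihx := ih hw
    obtain ⟨i, hi | hi⟩ := exists_hasEdge (SimpleGraph.Subgraph.coe_adj _ _ _ ▸ h)
    · have := (hφ i u x).1 hi
      have e1 := hi.2
      have e2 := this.2
      rw [ihx, e1] at e2
      exact (mul_right_cancel e2).symm
    · have := (hφ i x u).1 hi
      rw [this.2, ihx, ← hi.2]

theorem le_of_isomorphic {A B : (cayleyGraph n).Subgraph} {hA : 1 ∈ A.verts}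
    {hB : 1 ∈ B.verts} (hAB : Isomorphic A ⟨1, hA⟩ B ⟨1, hB⟩)
    (hc : ∀ v : A.verts, A.coe.Reachable v ⟨1, hA⟩) : A ≤ B := by
  obtain ⟨φ, h1, hφ⟩ := hAB
  have key := fun v => coe_eq_of_isomorphic h1 hφ v (hc v)
  refine ⟨fun v hv => ?_, fun u v huv => ?_⟩
  · have := (φ ⟨v, hv⟩).2
    rwa [key] at this
  · obtain ⟨i, hi | hi⟩ := exists_hasEdge huv
    · have := ((hφ i ⟨u, A.edge_vert huv⟩ ⟨v, A.edge_vert huv.symm⟩).1 hi).1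
      rwa [key, key] at this
    · have := ((hφ i ⟨v, A.edge_vert huv.symm⟩ ⟨u, A.edge_vert huv⟩).1 hi).1
      rw [key, key] at this
      exact this.symm

theorem Isomorphic.refl (A : (cayleyGraph n).Subgraph) (a : A.verts) : Isomorphic A a A a :=
  ⟨Equiv.refl _, rfl, fun _ _ _ => Iff.rfl⟩

theorem Isomorphic.symm {A B : (cayleyGraph n).Subgraph} {a : A.verts} {b : B.verts}
    (h : Isomorphic A a B b) : Isomorphic B b A a := by
  obtain ⟨φ, h1, hφ⟩ := h
  refine ⟨φ.symm, by rw [← h1]; simp, fun i u v => ?_⟩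
  rw [hφ]; simp

theorem Isomorphic.trans {A B C : (cayleyGraph n).Subgraph} {a : A.verts} {b : B.verts}
    {c : C.verts} (h : Isomorphic A a B b) (h' : Isomorphic B b C c) : Isomorphic A a C c := by
  obtain ⟨φ, h1, hφ⟩ := h
  obtain ⟨ψ, h2, hψ⟩ := h'
  exact ⟨φ.trans ψ, by simp [h1, h2], fun i u v => (hφ i u v).trans (hψ i _ _)⟩

theorem ball_reachable (T : TreeSpace n) (r : ℕ) (v : (ball T r).verts) :
    (ball T r).coe.Reachable v ⟨1, one_mem_ball T r⟩ := by
  suffices H : ∀ (k : ℕ) (v : (ball T r).verts),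
      T.graph.coe.dist ⟨1, T.one_mem⟩ ⟨v, v.2.1⟩ ≤ k →
      (ball T r).coe.Reachable v ⟨1, one_mem_ball T r⟩ from H _ v le_rfl
  intro k
  induction k with
  | zero =>
    intro v hv
    have hc : T.graph.coe.Connected := T.connected.coe
    have : (⟨1, T.one_mem⟩ : T.graph.verts) = ⟨v, v.2.1⟩ :=
      (hc.dist_eq_zero_iff).1 (Nat.le_zero.1 hv)
    have h2 : v = ⟨1, one_mem_ball T r⟩ := Subtype.ext (congrArg Subtype.val this).symm
    rw [h2]
  | succ k ih =>
    intro v hv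
    have hc : T.graph.coe.Connected := T.connected.coe
    obtain ⟨p, hp⟩ := hc.exists_walk_length_eq_dist ⟨v, v.2.1⟩ ⟨1, T.one_mem⟩
    rw [SimpleGraph.dist_comm] at hp
    generalize hw : (⟨v, v.2.1⟩ : T.graph.verts) = w at p hp hv
    cases p with
    | nil =>
      have h2 : v = ⟨1, one_mem_ball T r⟩ := Subtype.ext (by
        have h := congrArg Subtype.val hw
        exact h)
      rw [h2]
    | @cons _ x _ h q =>
      have hq := SimpleGraph.dist_le q
      rw [SimpleGraph.dist_comm] at hq
      rw [SimpleGraph.Walk.length_cons] at hp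
      have hvr : T.graph.coe.dist ⟨1, T.one_mem⟩ w ≤ r := hw ▸ v.2.2
      have hx : (x : FreeGroup (Fin n)) ∈ (ball T r).verts := ⟨x.2, by
        show T.graph.coe.dist ⟨1, T.one_mem⟩ x ≤ r
        omega⟩
      subst hw
      have hadj : (ball T r).Adj v x := ⟨v.2, hx, h⟩
      have h3 : (ball T r).coe.Adj v ⟨x, hx⟩ := hadj
      refine h3.reachable.trans (ih ⟨x, hx⟩ ?_)
      show T.graph.coe.dist ⟨1, T.one_mem⟩ x ≤ k
      omega

/-- Inside the Cayley graph of a free group, balls about the identity are isomorphic only if they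
are equal. -/
theorem ballsIsomorphic_iff (T T' : TreeSpace n) (r : ℕ) :
    BallsIsomorphic T T' r ↔ ball T r = ball T' r := by
  constructor
  · intro h
    exact le_antisymm (le_of_isomorphic h (ball_reachable T r))
      (le_of_isomorphic h.symm (ball_reachable T' r))
  · intro h
    have : ∀ (B : (cayleyGraph n).Subgraph) (hB : 1 ∈ B.verts), ball T r = B →
        Isomorphic (ball T r) ⟨1, one_mem_ball T r⟩ B ⟨1, hB⟩ := by
      rintro B hB rfl
      exact Isomorphic.refl _ _
    exact this _ _ h

theorem ball_zero_eq (T T' : TreeSpace n) : ball T 0 = ball T' 0 := by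
  have hv : ∀ (S : TreeSpace n) (v : FreeGroup (Fin n)), v ∈ (ball S 0).verts → v = 1 := by
    rintro S v ⟨h, h0⟩
    have := (S.connected.coe.dist_eq_zero_iff).1 (Nat.le_zero.1 h0)
    exact (congrArg Subtype.val this).symm
  have hle : ∀ S S' : TreeSpace n, ball S 0 ≤ ball S' 0 := by
    refine fun S S' => ⟨fun v h => ?_, fun u v h => ?_⟩
    · rw [hv S v h]; exact one_mem_ball S' 0
    · have h1 := hv S u ((ball S 0).edge_vert h)
      have h2 := hv S v ((ball S 0).edge_vert h.symm)
      subst h1; subst h2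
      exact absurd h (SimpleGraph.Subgraph.loopless _ |>.irrefl _)
  exact le_antisymm (hle T T') (hle T' T)

/-- Transfer of walks between trees with equal balls. -/
theorem exists_walk_of_ball_eq {T T' : TreeSpace n} {R : ℕ} (hR : ball T R = ball T' R)
    {u v : T.graph.verts} (p : T.graph.coe.Walk u v) (k : ℕ)
    (hu : T.graph.coe.dist ⟨1, T.one_mem⟩ u ≤ k) (hk : k + p.length ≤ R)
    (hu' : (u : FreeGroup (Fin n)) ∈ T'.graph.verts) :
    ∃ (hv' : (v : FreeGroup (Fin n)) ∈ T'.graph.verts) (q : T'.graph.coe.Walk ⟨u, hu'⟩ ⟨v, hv'⟩),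
      q.length = p.length := by
  induction p generalizing k with
  | nil => exact ⟨hu', .nil, rfl⟩
  | @cons u x v h p ih =>
    rw [SimpleGraph.Walk.length_cons] at hk
    have hx : T.graph.coe.dist ⟨1, T.one_mem⟩ x ≤ k + 1 := by
      have h1 := T.connected.coe.dist_triangle (u := ⟨1, T.one_mem⟩) (v := u) (w := x)
      rw [SimpleGraph.dist_eq_one_iff_adj.2 h] at h1
      omega
    have hadj : (ball T R).Adj u x := ⟨⟨u.2, by
      show T.graph.coe.dist ⟨1, T.one_mem⟩ u ≤ R; omega⟩, ⟨x.2, by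
      show T.graph.coe.dist ⟨1, T.one_mem⟩ x ≤ R; omega⟩, h⟩
    rw [hR] at hadj
    have hadj' : T'.graph.Adj u x := hadj.2.2
    have hx' := T'.graph.edge_vert hadj'.symm
    obtain ⟨hv', q, hq⟩ := ih (k + 1) hx (by omega) hx'
    have h3 : T'.graph.coe.Adj ⟨u, hu'⟩ ⟨x, hx'⟩ := hadj'
    exact ⟨hv', .cons h3 q, by simp [hq]⟩

theorem ball_le_of_ball_eq {T T' : TreeSpace n} {r R : ℕ} (h : r ≤ R)
    (hR : ball T R = ball T' R) : ball T r ≤ ball T' r := by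
  have hv : ∀ v ∈ (ball T r).verts, v ∈ (ball T' r).verts := by
    rintro v ⟨hv, hd⟩
    obtain ⟨p, hp⟩ := T.connected.coe.exists_walk_length_eq_dist ⟨1, T.one_mem⟩ ⟨v, hv⟩
    obtain ⟨hv', q, hq⟩ := exists_walk_of_ball_eq hR p 0 (by simp) (by omega) T'.one_mem
    exact ⟨hv', (SimpleGraph.dist_le q).trans (by omega)⟩
  refine ⟨hv, fun u v huv => ?_⟩
  obtain ⟨hu1, hv1, hT⟩ := huv
  refine ⟨hv u hu1, hv v hv1, ?_⟩
  have : (ball T R).Adj u v := ⟨⟨hu1.1, hu1.2.trans h⟩, ⟨hv1.1, hv1.2.trans h⟩, hT⟩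
  rw [hR] at this
  exact this.2.2

theorem ball_eq_of_le {T T' : TreeSpace n} {r R : ℕ} (h : r ≤ R)
    (hR : ball T R = ball T' R) : ball T r = ball T' r :=
  le_antisymm (ball_le_of_ball_eq h hR) (ball_le_of_ball_eq h hR.symm)

theorem eq_of_forall_ball_eq {T T' : TreeSpace n} (h : ∀ r, ball T r = ball T' r) : T = T' := by
  have hle : ∀ S S' : TreeSpace n, (∀ r, ball S r = ball S' r) → S.graph ≤ S'.graph := by
    refine fun S S' h => ⟨fun v hv => ?_, fun u v huv => ?_⟩
    · have : v ∈ (ball S (S.graph.coe.dist ⟨1, S.one_mem⟩ ⟨v, hv⟩)).verts := ⟨hv, le_rfl⟩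
      rw [h] at this
      exact this.1
    · have hu := S.graph.edge_vert huv
      have hv := S.graph.edge_vert huv.symm
      have : (ball S (max (S.graph.coe.dist ⟨1, S.one_mem⟩ ⟨u, hu⟩)
          (S.graph.coe.dist ⟨1, S.one_mem⟩ ⟨v, hv⟩))).Adj u v :=
        ⟨⟨hu, le_max_left _ _⟩, ⟨hv, le_max_right _ _⟩, huv⟩
      rw [h] at this
      exact this.2.2
  exact TreeSpace.ext (le_antisymm (hle T T' h) (hle T' T fun r => (h r).symm))

theorem boxDist_bddBelow (T T' : TreeSpace n) :
    BddBelow {d : ℝ | ∃ r : ℕ, BallsIsomorphic T T' r ∧ d = Real.exp (-(r : ℝ))} :=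
  ⟨0, by rintro d ⟨r, -, rfl⟩; exact (Real.exp_pos _).le⟩

theorem boxDist_nonempty (T T' : TreeSpace n) :
    {d : ℝ | ∃ r : ℕ, BallsIsomorphic T T' r ∧ d = Real.exp (-(r : ℝ))}.Nonempty :=
  ⟨_, 0, (ballsIsomorphic_iff T T' 0).2 (ball_zero_eq T T'), rfl⟩

theorem boxDist_le_iff (T T' : TreeSpace n) (r : ℕ) :
    boxDist T T' ≤ Real.exp (-(r : ℝ)) ↔ ball T r = ball T' r := by
  constructor
  · intro h
    by_contra hne
    have hr : r ≠ 0 := by rintro rfl; exact hne (ball_zero_eq T T')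
    have h2 : Real.exp (-((r - 1 : ℕ) : ℝ)) ≤ boxDist T T' := by
      refine le_csInf (boxDist_nonempty T T') ?_
      rintro d ⟨s, hs, rfl⟩
      have : s < r := by
        by_contra hsr
        exact hne (ball_eq_of_le (not_lt.1 hsr) ((ballsIsomorphic_iff T T' s).1 hs))
      rw [Real.exp_le_exp, neg_le_neg_iff]
      exact_mod_cast Nat.le_sub_one_of_lt this
    have h3 := h2.trans h
    rw [Real.exp_le_exp, neg_le_neg_iff] at h3
    have h4 : r ≤ r - 1 := by exact_mod_cast h3
    omega
  · intro h
    exact csInf_le (boxDist_bddBelow T T') ⟨r, (ballsIsomorphic_iff T T' r).2 h, rfl⟩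

theorem boxDist_nonneg (T T' : TreeSpace n) : 0 ≤ boxDist T T' :=
  le_csInf (boxDist_nonempty T T') (by rintro d ⟨r, -, rfl⟩; exact (Real.exp_pos _).le)

theorem exists_exp_lt {d : ℝ} (hd : 0 < d) : ∃ r : ℕ, Real.exp (-(r : ℝ)) < d := by
  have h : Filter.Tendsto (fun r : ℕ => Real.exp (-(r : ℝ))) Filter.atTop (nhds 0) :=
    Real.tendsto_exp_neg_atTop_nhds_zero.comp tendsto_natCast_atTop_atTop
  exact (h.eventually (gt_mem_nhds hd)).exists

/-- The box metric makes `X_n` a metric space. -/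
noncomputable instance : MetricSpace (TreeSpace n) where
  dist := boxDist
  dist_self := fun T => le_antisymm (le_of_forall_pos_lt_add fun d hd => by
    obtain ⟨r, hr⟩ := exists_exp_lt hd
    rw [zero_add]
    exact ((boxDist_le_iff T T r).2 rfl).trans_lt hr) (boxDist_nonneg T T)
  dist_comm := fun T T' => by
    have : ∀ r, BallsIsomorphic T T' r ↔ BallsIsomorphic T' T r := fun r =>
      ⟨fun h => h.symm, fun h => h.symm⟩
    simp only [boxDist, this]
  dist_triangle := fun T T' T'' => by
    have key : ∀ r s : ℕ, BallsIsomorphic T T' r → BallsIsomorphic T' T'' s →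
        boxDist T T'' ≤ Real.exp (-(r : ℝ)) + Real.exp (-(s : ℝ)) := by
      intro r s hr hs
      rw [ballsIsomorphic_iff] at hr hs
      have h := (boxDist_le_iff T T'' (min r s)).2
        ((ball_eq_of_le (min_le_left r s) hr).trans (ball_eq_of_le (min_le_right r s) hs))
      rcases min_choice r s with h' | h' <;> rw [h'] at h
      · linarith [Real.exp_pos (-(s : ℝ))]
      · linarith [Real.exp_pos (-(r : ℝ))]
    have h1 : ∀ s : ℕ, BallsIsomorphic T' T'' s →
        boxDist T T'' - Real.exp (-(s : ℝ)) ≤ boxDist T T' := by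
      intro s hs
      refine le_csInf (boxDist_nonempty T T') ?_
      rintro d ⟨r, hr, rfl⟩
      linarith [key r s hr hs]
    have h2 : boxDist T T'' - boxDist T T' ≤ boxDist T' T'' := by
      refine le_csInf (boxDist_nonempty T' T'') ?_
      rintro d ⟨s, hs, rfl⟩
      linarith [h1 s hs]
    linarith
  eq_of_dist_eq_zero := fun {T T'} h => eq_of_forall_ball_eq fun r =>
    (boxDist_le_iff T T' r).1 ((show boxDist T T' = 0 from h).le.trans (Real.exp_pos _).le)

theorem dist_le_exp_iff (T T' : TreeSpace n) (r : ℕ) :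
    dist T T' ≤ Real.exp (-(r : ℝ)) ↔ ball T r = ball T' r :=
  boxDist_le_iff T T' r

/-! ## The pseudogroup of the space of pointed trees -/

/-- The graph `g⁻¹ T`. -/
def translateGraph (A : (cayleyGraph n).Subgraph) (g : FreeGroup (Fin n)) :
    (cayleyGraph n).Subgraph where
  verts := {v | g * v ∈ A.verts}
  Adj u v := A.Adj (g * u) (g * v)
  adj_sub := fun {u v} h => by
    have h' := A.adj_sub h
    rw [SimpleGraph.mulCayley_adj'] at h' ⊢
    obtain ⟨hne, s, hs, h1 | h1⟩ := h'
    · exact ⟨fun e => hne (e ▸ rfl), s, hs, Or.inl (mul_left_cancel (by rwa [← mul_assoc]))⟩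
    · exact ⟨fun e => hne (e ▸ rfl), s, hs, Or.inr (mul_left_cancel (by rwa [← mul_assoc]))⟩
  edge_vert := fun h => A.edge_vert h
  symm := ⟨fun _ _ h => SimpleGraph.Subgraph.Adj.symm h⟩

/-- Left multiplication by `g` is an isomorphism from `g⁻¹ T` onto `T`. -/
def translateIso (A : (cayleyGraph n).Subgraph) (g : FreeGroup (Fin n)) :
    (translateGraph A g).coe ≃g A.coe where
  toFun v := ⟨g * v, v.2⟩
  invFun v := ⟨g⁻¹ * v, by show g * (g⁻¹ * v) ∈ A.verts; rw [mul_inv_cancel_left]; exact v.2⟩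
  left_inv v := by ext; simp
  right_inv v := by ext; simp
  map_rel_iff' := Iff.rfl

/-- The pointed tree `(T, e) · g`, for a vertex `g` of `T`: the subgraph of the Cayley graph which,
pointed at `e`, is isomorphic to `(T, g)`. -/
def translate (T : TreeSpace n) (g : FreeGroup (Fin n)) (hg : g ∈ T.graph.verts) :
    TreeSpace n where
  graph := translateGraph T.graph g
  one_mem := by show g * 1 ∈ T.graph.verts; rwa [mul_one]
  connected := ⟨(translateIso T.graph g).connected_iff.2 T.connected.coe⟩
  acyclic := (translateIso T.graph g).isAcyclic_iff.2 T.acyclic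
  infinite := by
    have : (translateGraph T.graph g).verts = (fun v => g⁻¹ * v) '' T.graph.verts := by
      ext v
      constructor
      · intro hv
        exact ⟨g * v, hv, by simp⟩
      · rintro ⟨w, hw, rfl⟩
        show g * (g⁻¹ * w) ∈ T.graph.verts
        rwa [mul_inv_cancel_left]
    rw [this]
    exact T.infinite.image (mul_right_injective _).injOn

theorem isomorphic_translate (T : TreeSpace n) (g : FreeGroup (Fin n))
    (hg : g ∈ T.graph.verts) :
    Isomorphic T.graph ⟨g, hg⟩ (translate T g hg).graph ⟨1, (translate T g hg).one_mem⟩ := by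
  refine Isomorphic.symm ⟨(translateIso T.graph g).toEquiv, ?_, fun i u v => ?_⟩
  · exact Subtype.ext (mul_one g)
  · show (T.graph.Adj (g * u) (g * v) ∧ _) ↔ (T.graph.Adj (g * u) (g * v) ∧ _)
    refine and_congr_right fun _ => ?_
    show (v : FreeGroup (Fin n)) = u * FreeGroup.of i ↔
      g * (v : FreeGroup (Fin n)) = g * u * FreeGroup.of i
    rw [mul_assoc, mul_right_inj]

/-- `(T', e) = (T, e) · g` if and only if `(T, g)` and `(T', e)` are isomorphic. -/
theorem eq_translate_iff (T T' : TreeSpace n) (g : FreeGroup (Fin n)) (hg : g ∈ T.graph.verts) :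
    T' = translate T g hg ↔ Isomorphic T.graph ⟨g, hg⟩ T'.graph ⟨1, T'.one_mem⟩ := by
  constructor
  · rintro rfl
    exact isomorphic_translate T g hg
  · intro h
    have h' := h.symm.trans (isomorphic_translate T g hg)
    exact TreeSpace.ext (le_antisymm
      (le_of_isomorphic h' fun v => T'.connected.coe.preconnected v _)
      (le_of_isomorphic h'.symm fun v => (translate T g hg).connected.coe.preconnected v _))

theorem ball_translate_le {T T' : TreeSpace n} {g : FreeGroup (Fin n)} (hg : g ∈ T.graph.verts)
    (hg' : g ∈ T'.graph.verts) {r R : ℕ}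
    (hd : T.graph.coe.dist ⟨1, T.one_mem⟩ ⟨g, hg⟩ + r ≤ R) (hR : ball T R = ball T' R) :
    ball (translate T g hg) r ≤ ball (translate T' g hg') r := by
  have hdist : ∀ v (hv : v ∈ (translate T g hg).graph.verts),
      (translate T g hg).graph.coe.dist ⟨1, (translate T g hg).one_mem⟩ ⟨v, hv⟩ ≤ r →
      ∃ p : T.graph.coe.Walk ⟨g, hg⟩ ⟨g * v, hv⟩, p.length ≤ r := by
    intro v hv h
    obtain ⟨p, hp⟩ := (translate T g hg).connected.coe.exists_walk_length_eq_dist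
      ⟨1, (translate T g hg).one_mem⟩ ⟨v, hv⟩
    have e1 : (translateIso T.graph g) ⟨1, (translate T g hg).one_mem⟩ = ⟨g, hg⟩ :=
      Subtype.ext (mul_one g)
    have e2 : (translateIso T.graph g) ⟨v, hv⟩ = ⟨g * v, hv⟩ := rfl
    refine ⟨(p.map (translateIso T.graph g).toHom).copy e1 e2, ?_⟩
    exact ((SimpleGraph.Walk.length_copy _ e1 e2).trans (SimpleGraph.Walk.length_map _ p)).le.trans
      (hp.le.trans h)
  have hv : ∀ v ∈ (ball (translate T g hg) r).verts,
      v ∈ (ball (translate T' g hg') r).verts ∧ g * v ∈ (ball T R).verts := by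
    rintro v ⟨hv, h⟩
    obtain ⟨p, hp⟩ := hdist v hv h
    obtain ⟨hv', q, hq⟩ := exists_walk_of_ball_eq hR p _ le_rfl (by omega) hg'
    refine ⟨⟨hv', ?_⟩, hv, ?_⟩
    · have e1 : (translateIso T'.graph g).symm ⟨g, hg'⟩ =
          ⟨1, (translate T' g hg').one_mem⟩ := Subtype.ext (inv_mul_cancel g)
      have e2 : (translateIso T'.graph g).symm ⟨g * v, hv'⟩ = ⟨v, hv'⟩ :=
        Subtype.ext (inv_mul_cancel_left g v)
      have := SimpleGraph.dist_le ((q.map (translateIso T'.graph g).symm.toHom).copy e1 e2)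
      rw [SimpleGraph.Walk.length_copy, SimpleGraph.Walk.length_map] at this
      exact this.trans (by omega)
    · have h1 := T.connected.coe.dist_triangle (u := ⟨1, T.one_mem⟩) (v := ⟨g, hg⟩)
        (w := ⟨g * v, hv⟩)
      have h2 := SimpleGraph.dist_le p
      omega
  refine ⟨fun v h => (hv v h).1, fun u v huv => ?_⟩
  obtain ⟨hu1, hv1, hT⟩ := huv
  refine ⟨(hv u hu1).1, (hv v hv1).1, ?_⟩
  have : (ball T R).Adj (g * u) (g * v) := ⟨(hv u hu1).2, (hv v hv1).2, hT⟩
  rw [hR] at this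
  exact this.2.2

theorem mem_of_ball_eq {T T' : TreeSpace n} {g : FreeGroup (Fin n)} (hg : g ∈ T.graph.verts)
    {R : ℕ} (hd : T.graph.coe.dist ⟨1, T.one_mem⟩ ⟨g, hg⟩ ≤ R) (hR : ball T R = ball T' R) :
    ∃ hg' : g ∈ T'.graph.verts, T'.graph.coe.dist ⟨1, T'.one_mem⟩ ⟨g, hg'⟩ ≤
      T.graph.coe.dist ⟨1, T.one_mem⟩ ⟨g, hg⟩ := by
  have h : g ∈ (ball T (T.graph.coe.dist ⟨1, T.one_mem⟩ ⟨g, hg⟩)).verts := ⟨hg, le_rfl⟩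
  rw [ball_eq_of_le hd hR] at h
  exact h

theorem isOpen_mem (g : FreeGroup (Fin n)) : IsOpen {T : TreeSpace n | g ∈ T.graph.verts} := by
  rw [Metric.isOpen_iff]
  intro T hT
  refine ⟨Real.exp (-((T.graph.coe.dist ⟨1, T.one_mem⟩ ⟨g, hT⟩ : ℕ) : ℝ)), Real.exp_pos _, ?_⟩
  intro T' hT'
  have h := (dist_le_exp_iff T T' _).1 (by rw [dist_comm]; exact (Metric.mem_ball.1 hT').le)
  exact (mem_of_ball_eq hT le_rfl h).1

open Classical in
/-- The map `T ↦ T · g`, extended by the identity outside its domain. -/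
noncomputable def shiftFun (g : FreeGroup (Fin n)) (T : TreeSpace n) : TreeSpace n :=
  if hg : g ∈ T.graph.verts then translate T g hg else T

theorem shiftFun_of_mem {g : FreeGroup (Fin n)} {T : TreeSpace n} (hg : g ∈ T.graph.verts) :
    shiftFun g T = translate T g hg := dif_pos hg

theorem inv_mem_shiftFun {g : FreeGroup (Fin n)} {T : TreeSpace n} (hg : g ∈ T.graph.verts) :
    g⁻¹ ∈ (shiftFun g T).graph.verts := by
  rw [shiftFun_of_mem hg]
  show g * g⁻¹ ∈ T.graph.verts
  rw [mul_inv_cancel]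
  exact T.one_mem

theorem shiftFun_inv_shiftFun {g : FreeGroup (Fin n)} {T : TreeSpace n}
    (hg : g ∈ T.graph.verts) : shiftFun g⁻¹ (shiftFun g T) = T := by
  rw [shiftFun_of_mem (inv_mem_shiftFun hg)]
  apply TreeSpace.ext
  have h : (shiftFun g T).graph = translateGraph T.graph g := by rw [shiftFun_of_mem hg]; rfl
  show translateGraph (shiftFun g T).graph g⁻¹ = T.graph
  rw [h]
  apply SimpleGraph.Subgraph.ext
  · ext v
    show g * (g⁻¹ * v) ∈ T.graph.verts ↔ _
    rw [mul_inv_cancel_left]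
  · ext u v
    show T.graph.Adj (g * (g⁻¹ * u)) (g * (g⁻¹ * v)) ↔ _
    rw [mul_inv_cancel_left, mul_inv_cancel_left]

theorem continuousOn_shiftFun (g : FreeGroup (Fin n)) :
    ContinuousOn (shiftFun g) {T : TreeSpace n | g ∈ T.graph.verts} := by
  intro T hT
  rw [Metric.continuousWithinAt_iff]
  intro ε hε
  obtain ⟨r, hr⟩ := exists_exp_lt hε
  refine ⟨Real.exp (-((T.graph.coe.dist ⟨1, T.one_mem⟩ ⟨g, hT⟩ + r : ℕ) : ℝ)),
    Real.exp_pos _, ?_⟩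
  intro T' hT' hd
  have hb := (dist_le_exp_iff T' T _).1 hd.le
  obtain ⟨hg', hdg⟩ := mem_of_ball_eq hT (Nat.le_add_right _ r) hb.symm
  rw [shiftFun_of_mem hT, shiftFun_of_mem hg']
  refine lt_of_le_of_lt ((dist_le_exp_iff _ _ r).2 (le_antisymm ?_ ?_)) hr
  · exact ball_translate_le hg' hT (by omega) hb
  · exact ball_translate_le hT hg' le_rfl hb.symm

/-- The local homeomorphism `τ_g : (T, e) ↦ (T, e) · g`. Its domain consists of the trees `T` in
which some path without self-intersections from `e` spells `g`; inside the Cayley graph of `F_n`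
these are the trees that have `g` as a vertex. -/
noncomputable def shift (g : FreeGroup (Fin n)) :
    OpenPartialHomeomorph (TreeSpace n) (TreeSpace n) where
  toFun := shiftFun g
  invFun := shiftFun g⁻¹
  source := {T | g ∈ T.graph.verts}
  target := {T | g⁻¹ ∈ T.graph.verts}
  map_source' := fun _ hT => inv_mem_shiftFun hT
  map_target' := fun T hT => by
    have := inv_mem_shiftFun (T := T) hT
    rwa [inv_inv] at this
  left_inv' := fun _ hT => shiftFun_inv_shiftFun hT
  right_inv' := fun T hT => by
    have := shiftFun_inv_shiftFun (T := T) hT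
    rwa [inv_inv] at this
  open_source := isOpen_mem g
  open_target := isOpen_mem g⁻¹
  continuousOn_toFun := continuousOn_shiftFun g
  continuousOn_invFun := continuousOn_shiftFun g⁻¹

/-- The pseudogroup `𝔊_n` on `X_n` generated by the maps `τ_g`, `g ∈ F_n`. -/
noncomputable def treePseudogroup (n : ℕ) : TransPseudogroup (TreeSpace n) :=
  TransPseudogroup.generate (Set.range shift)

end PointedTrees

/-! A point `x` is coded by the set of words in finitely many generators `p i` that can be applied
to it. Reading words from left to right, let `Φ(x)` be the subgraph of the Cayley graph spanned by
the elements whose reduced words are defined at `x` (`domainTree`). Prefixes of a defined word are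
defined, so this graph is connected; it inherits acyclicity from the Cayley graph; and it is
infinite as soon as some `p i` is the identity.

Equivariance is formal. For a reduced word `g` defined at `x`, the product `g * h` is defined at `x`
exactly when `h` is defined at the image of `x` (`mem_source_elementMap_mul`), which says that `Φ`
carries the action of `g` to the shift by `g` (`domainTree_elementMap`). Two properties of the
generators make `Φ` a closed embedding. If their domains are clopen, membership in the domain of
each word is locally constant, and a ball of `Φ(x)` depends on finitely many words; hence `Φ` is
continuous (`continuous_domainTree`). If the domains of words separate points, `Φ` is injective, and
compactness of the source does the rest.

Generators of this kind come from the compact generating system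
(`IsCompactGeneratingSystem.exists_separating`). Dimension zero allows each element of `Λ` to be
extended to a clopen domain. Added to these are the identity, finitely many maps that bring every
point into `Y`, and the identities of clopen cells of diameter less than `ε`. Points that no word
distinguishes share a cell, and so do their images under every word defined at them; they stay at
distance less than `ε` forever, which expansiveness forbids for distinct points of `Y`.

The converse passage, from the whole pseudogroup on trees to maps of the original space, is reduced
to the shifts by showing that the transformations that restrict well to the image form a pseudogroup
(`pushforward`). -/

namespace TransPseudogroup

/-! ## Words in a family of partial homeomorphisms -/

section Words

variable {α X : Type*} [TopologicalSpace X]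

/-- The composition of the partial homeomorphisms `p i` and `(p i)⁻¹` spelled by a word. -/
def wordMap (p : α → OpenPartialHomeomorph X X) : List (α × Bool) → OpenPartialHomeomorph X X
  | [] => OpenPartialHomeomorph.refl X
  | (i, b) :: L => (cond b (p i) (p i).symm).trans (wordMap p L)

variable (p : α → OpenPartialHomeomorph X X)

theorem wordMap_cons (i : α) (b : Bool) (L : List (α × Bool)) :
    wordMap p ((i, b) :: L) = (cond b (p i) (p i).symm).trans (wordMap p L) := rfl

theorem wordMap_append (L L' : List (α × Bool)) :
    wordMap p (L ++ L') = (wordMap p L).trans (wordMap p L') := by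
  induction L with
  | nil => simp [wordMap]
  | cons a L ih => simp [wordMap, ih, OpenPartialHomeomorph.trans_assoc]

theorem wordMap_singleton_true (i : α) : wordMap p [(i, true)] = p i := by
  simp [wordMap]

theorem wordMap_singleton_false (i : α) : wordMap p [(i, false)] = (p i).symm := by
  simp [wordMap]

theorem wordMap_invRev (L : List (α × Bool)) :
    wordMap p (FreeGroup.invRev L) = (wordMap p L).symm := by
  induction L with
  | nil => rfl
  | cons a L ih =>
    have : FreeGroup.invRev (a :: L) = FreeGroup.invRev L ++ [(a.1, !a.2)] := by
      simp [FreeGroup.invRev]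
    rw [this, wordMap_append, ih]
    obtain ⟨i, b⟩ := a
    cases b <;> simp [wordMap, OpenPartialHomeomorph.trans_symm_eq_symm_trans_symm]

/-- A cancelling pair acts as the identity on a possibly smaller domain, so erasing it can only
enlarge the domain and keeps the values. -/
theorem wordMap_of_red {L L' : List (α × Bool)} (h : FreeGroup.Red L L') {x : X}
    (hx : x ∈ (wordMap p L).source) :
    x ∈ (wordMap p L').source ∧ wordMap p L' x = wordMap p L x := by
  induction h with
  | refl => exact ⟨hx, rfl⟩
  | tail _ h ih =>
    obtain ⟨h1, h2⟩ := ih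
    rw [← h2]
    obtain @⟨L₁, L₂, i, b⟩ := h
    have hb : cond (!b) (p i) (p i).symm = (cond b (p i) (p i).symm).symm := by cases b <;> rfl
    rw [wordMap_append, wordMap_cons, wordMap_cons, hb] at h1
    rw [wordMap_append, wordMap_append, wordMap_cons, wordMap_cons, hb]
    obtain ⟨h1, h3, h4⟩ := h1
    have e : (cond b (p i) (p i).symm).symm ((cond b (p i) (p i).symm) (wordMap p L₁ x)) =
      wordMap p L₁ x := (cond b (p i) (p i).symm).left_inv h3
    have h5 : (cond b (p i) (p i).symm).symm ((cond b (p i) (p i).symm) (wordMap p L₁ x)) ∈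
      (wordMap p L₂).source := h4.2
    rw [e] at h5
    refine ⟨⟨h1, h5⟩, ?_⟩
    simp only [OpenPartialHomeomorph.coe_trans, Function.comp_apply, e]

theorem isClosed_source_wordMap (hp : ∀ i, IsClosed (p i).source)
    (hp' : ∀ i, IsClosed (p i).target) (L : List (α × Bool)) :
    IsClosed (wordMap p L).source := by
  induction L with
  | nil => exact isClosed_univ
  | cons a L ih =>
    obtain ⟨i, b⟩ := a
    have hc : IsClosed (cond b (p i) (p i).symm).source := by
      cases b
      · exact hp' i
      · exact hp i
    exact (OpenPartialHomeomorph.continuousOn _).preimage_isClosed_of_isClosed hc ih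

variable [DecidableEq α]

/-- The composition spelled by the reduced word of an element of the free group. -/
def elementMap (g : FreeGroup α) : OpenPartialHomeomorph X X :=
  wordMap p g.toWord

theorem elementMap_mk {L : List (α × Bool)} {x : X} (hx : x ∈ (wordMap p L).source) :
    x ∈ (elementMap p (FreeGroup.mk L)).source ∧
      elementMap p (FreeGroup.mk L) x = wordMap p L x := by
  rw [elementMap, FreeGroup.toWord_mk]
  exact wordMap_of_red p FreeGroup.reduce.red hx

@[simp]
theorem elementMap_one : elementMap p 1 = OpenPartialHomeomorph.refl X := by
  simp [elementMap, wordMap]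

@[simp]
theorem elementMap_of (i : α) : elementMap p (FreeGroup.of i) = p i := by
  rw [elementMap, FreeGroup.toWord_of, wordMap_singleton_true]

theorem elementMap_inv (g : FreeGroup α) : elementMap p g⁻¹ = (elementMap p g).symm := by
  rw [elementMap, FreeGroup.toWord_inv, wordMap_invRev, elementMap]

theorem elementMap_mul_aux {g h : FreeGroup α} {x : X} (hg : x ∈ (elementMap p g).source)
    (hh : elementMap p g x ∈ (elementMap p h).source) :
    x ∈ (elementMap p (g * h)).source ∧
      elementMap p (g * h) x = elementMap p h (elementMap p g x) := by
  have hx : x ∈ (wordMap p (g.toWord ++ h.toWord)).source := by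
    rw [wordMap_append]
    exact ⟨hg, hh⟩
  have := elementMap_mk p hx
  rw [← FreeGroup.mul_mk, FreeGroup.mk_toWord, FreeGroup.mk_toWord, wordMap_append] at this
  exact this

/-- Cancellation makes the map of `g * h` an extension of the composition, but at points where `g`
is defined nothing is gained: apply `elementMap_mul_aux` to `g⁻¹` and `g * h` at the image of `x`,
where the product is `h`. Both equivariance and injectivity of the coding rest on this. -/
theorem mem_source_elementMap_mul {g h : FreeGroup α} {x : X}
    (hg : x ∈ (elementMap p g).source) :
    x ∈ (elementMap p (g * h)).source ↔ elementMap p g x ∈ (elementMap p h).source := by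
  refine ⟨fun hx => ?_, fun hh => (elementMap_mul_aux p hg hh).1⟩
  have h1 : elementMap p g x ∈ (elementMap p g⁻¹).source := by
    rw [elementMap_inv]
    exact (elementMap p g).map_source hg
  have h2 : elementMap p g⁻¹ (elementMap p g x) = x := by
    rw [elementMap_inv]
    exact (elementMap p g).left_inv hg
  have := (elementMap_mul_aux p h1 (h := g * h) (by rwa [h2])).1
  rwa [inv_mul_cancel_left] at this

end Words

end TransPseudogroup

namespace PointedTrees

open TransPseudogroup

/-! ## The Cayley graph of a free group is a tree -/

section Cayley

variable {n : ℕ}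

/-- The condition says that the reduced word of `v` begins with `a`, that is, `v` lies beyond the
edge from `1` to `a`; only that edge can change it. Inverses are used so that multiplication by a
generator prepends a letter, which `FreeGroup.reduce.cons` handles. -/
theorem getLast?_toWord_inv_mul_of {a i : Fin n} {v : FreeGroup (Fin n)}
    (hv : ¬ (v = 1 ∧ i = a)) :
    (v⁻¹.toWord.getLast? = some (a, false)) ↔
      ((v * FreeGroup.of i)⁻¹.toWord.getLast? = some (a, false)) := by
  have h : (v * FreeGroup.of i)⁻¹.toWord = FreeGroup.reduce ((i, false) :: v⁻¹.toWord) := by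
    rw [mul_inv_rev, FreeGroup.toWord_mul, FreeGroup.toWord_inv, FreeGroup.toWord_of]
    rfl
  have hv' : v⁻¹.toWord = [] → i ≠ a := by
    intro h1 h2
    rw [FreeGroup.toWord_eq_nil_iff, inv_eq_one] at h1
    exact hv ⟨h1, h2⟩
  rw [h, FreeGroup.reduce.cons, FreeGroup.reduce_toWord]
  generalize v⁻¹.toWord = w at hv'
  match w with
  | [] => simpa using hv'
  | [c] =>
    obtain ⟨j, b⟩ := c
    by_cases hc : i = j ∧ b = true
    · obtain ⟨rfl, rfl⟩ := hc
      simp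
    · simp [hc]
  | c :: d :: w =>
    by_cases hc : i = c.1 ∧ c.2 = true
    · simp [hc]
    · simp [hc]

theorem cayleyGraph_adj_iff {u v : FreeGroup (Fin n)} :
    (cayleyGraph n).Adj u v ↔ ∃ i, v = u * FreeGroup.of i ∨ u = v * FreeGroup.of i := by
  rw [SimpleGraph.mulCayley_adj']
  constructor
  · rintro ⟨-, -, ⟨i, rfl⟩, h | h⟩
    · exact ⟨i, Or.inl h.symm⟩
    · exact ⟨i, Or.inr h⟩
  · rintro ⟨i, rfl | rfl⟩
    · exact ⟨by simp, _, ⟨i, rfl⟩, Or.inl rfl⟩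
    · exact ⟨by simp, _, ⟨i, rfl⟩, Or.inr rfl⟩

theorem isBridge_cayleyGraph (g : FreeGroup (Fin n)) (a : Fin n) :
    (cayleyGraph n).IsBridge s(g, g * FreeGroup.of a) := by
  rw [SimpleGraph.isBridge_iff]
  rintro ⟨q⟩
  -- Along a walk that avoids the edge, whether the word relative to `g` begins with `a` is
  -- invariant; it is false at `g` and true at the other endpoint.
  have key : ∀ {u v : FreeGroup (Fin n)}
      (_ : ((cayleyGraph n).deleteEdges {s(g, g * FreeGroup.of a)}).Walk u v),
      ((g⁻¹ * u)⁻¹.toWord.getLast? = some (a, false)) ↔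
        ((g⁻¹ * v)⁻¹.toWord.getLast? = some (a, false)) := by
    intro u v q
    induction q with
    | nil => exact Iff.rfl
    | @cons u x v h q ih =>
      rw [← ih]
      rw [SimpleGraph.deleteEdges_adj, cayleyGraph_adj_iff] at h
      obtain ⟨⟨i, rfl | rfl⟩, h2⟩ := h
      · rw [← mul_assoc]
        refine getLast?_toWord_inv_mul_of ?_
        rintro ⟨h3, rfl⟩
        rw [inv_mul_eq_one] at h3
        subst h3
        exact h2 rfl
      · rw [← mul_assoc]
        refine (getLast?_toWord_inv_mul_of ?_).symm
        rintro ⟨h3, rfl⟩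
        rw [inv_mul_eq_one] at h3
        subst h3
        exact h2 Sym2.eq_swap
  have := key q
  simp [FreeGroup.toWord_inv, FreeGroup.invRev] at this

theorem isAcyclic_cayleyGraph (n : ℕ) : (cayleyGraph n).IsAcyclic := by
  rw [SimpleGraph.isAcyclic_iff_forall_adj_isBridge]
  intro u v h
  obtain ⟨i, rfl | rfl⟩ := cayleyGraph_adj_iff.1 h
  · exact isBridge_cayleyGraph u i
  · rw [Sym2.eq_swap]
    exact isBridge_cayleyGraph v i

/-- An edge changes the word length by at most one, so distances from `1` in any subgraph are
bounded below by word length. -/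
theorem norm_le_length {A : (cayleyGraph n).Subgraph} {u v : A.verts} (q : A.coe.Walk u v) :
    (v : FreeGroup (Fin n)).norm ≤ (u : FreeGroup (Fin n)).norm + q.length := by
  induction q with
  | nil => simp
  | @cons u x v h q ih =>
    have h1 : (x : FreeGroup (Fin n)).norm ≤ (u : FreeGroup (Fin n)).norm + 1 := by
      obtain ⟨i, hi | hi⟩ := cayleyGraph_adj_iff.1 (A.adj_sub h)
      · rw [hi]
        exact (FreeGroup.norm_mul_le _ _).trans (by simp)
      · rw [eq_mul_inv_of_mul_eq hi.symm]
        exact (FreeGroup.norm_mul_le _ _).trans (by simp [FreeGroup.norm_inv_eq])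
    rw [SimpleGraph.Walk.length_cons]
    omega

theorem finite_norm_le (r : ℕ) : {g : FreeGroup (Fin n) | g.norm ≤ r}.Finite :=
  (List.finite_length_le (Fin n × Bool) r).preimage FreeGroup.toWord_injective.injOn

end Cayley

/-! ## The tree of the reduced words that are defined at a point -/

section DomainTree

variable {X : Type*} [TopologicalSpace X] {n : ℕ} (p : Fin n → OpenPartialHomeomorph X X)

/-- The subgraph of the Cayley graph that is spanned by the elements whose reduced words are
defined at `x`. -/
def domainGraph (x : X) : (cayleyGraph n).Subgraph :=
  (⊤ : (cayleyGraph n).Subgraph).induce {g | x ∈ (elementMap p g).source}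

theorem mem_domainGraph {x : X} {g : FreeGroup (Fin n)} :
    g ∈ (domainGraph p x).verts ↔ x ∈ (elementMap p g).source := Iff.rfl

theorem domainGraph_adj {x : X} {g h : FreeGroup (Fin n)} :
    (domainGraph p x).Adj g h ↔ x ∈ (elementMap p g).source ∧ x ∈ (elementMap p h).source ∧
      (cayleyGraph n).Adj g h := Iff.rfl

/-- The prefixes of a word defined at `x` are themselves defined at `x`, and they trace the walk. -/
theorem exists_walk_domainGraph (x : X) (L : List (Fin n × Bool))
    (hL : x ∈ (wordMap p L).source) :
    ∃ (h1 : 1 ∈ (domainGraph p x).verts) (hg : FreeGroup.mk L ∈ (domainGraph p x).verts)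
      (q : (domainGraph p x).coe.Walk ⟨1, h1⟩ ⟨_, hg⟩), q.length = L.length := by
  induction L using List.reverseRecOn with
  | nil =>
    have h1 : 1 ∈ (domainGraph p x).verts := by simp [mem_domainGraph]
    exact ⟨h1, h1, .nil, rfl⟩
  | append_singleton L a ih =>
    have hL' := hL
    rw [wordMap_append] at hL'
    obtain ⟨h1, hg, q, hq⟩ := ih hL'.1
    have hg' : FreeGroup.mk (L ++ [a]) ∈ (domainGraph p x).verts := (elementMap_mk p hL).1
    have hadj : (cayleyGraph n).Adj (FreeGroup.mk L) (FreeGroup.mk (L ++ [a])) := by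
      rw [cayleyGraph_adj_iff, ← FreeGroup.mul_mk]
      obtain ⟨i, b⟩ := a
      cases b
      · refine ⟨i, Or.inr ?_⟩
        rw [mul_assoc]
        have : (FreeGroup.mk [(i, false)]) = (FreeGroup.of i)⁻¹ := rfl
        rw [this, inv_mul_cancel, mul_one]
      · exact ⟨i, Or.inl rfl⟩
    have h3 : (domainGraph p x).coe.Adj ⟨_, hg⟩ ⟨_, hg'⟩ := ⟨hg, hg', hadj⟩
    exact ⟨h1, hg', q.concat h3, by simp [SimpleGraph.Walk.length_concat, hq]⟩

theorem exists_walk_of_mem_domainGraph {x : X} {g : FreeGroup (Fin n)}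
    (hg : g ∈ (domainGraph p x).verts) :
    ∃ (h1 : 1 ∈ (domainGraph p x).verts)
      (q : (domainGraph p x).coe.Walk ⟨1, h1⟩ ⟨g, hg⟩), q.length = g.norm := by
  obtain ⟨h1, hg', q, hq⟩ := exists_walk_domainGraph p x g.toWord hg
  have e : (⟨_, hg'⟩ : (domainGraph p x).verts) = ⟨g, hg⟩ := Subtype.ext FreeGroup.mk_toWord
  exact ⟨h1, q.copy rfl e, (SimpleGraph.Walk.length_copy _ _ _).trans hq⟩

/-- An identity generator supplies a ray in every tree, which makes the trees non-compact. -/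
theorem of_pow_mem_domainGraph {i : Fin n} (hi : p i = OpenPartialHomeomorph.refl X) (x : X)
    (k : ℕ) : FreeGroup.of i ^ k ∈ (domainGraph p x).verts := by
  have : ∀ k, wordMap p (List.replicate k (i, true)) = OpenPartialHomeomorph.refl X := by
    intro k
    induction k with
    | zero => rfl
    | succ k ih => simp [List.replicate_succ, wordMap, ih, hi]
  rw [mem_domainGraph, elementMap, FreeGroup.toWord_of_pow, this]
  trivial

variable (hp : ∃ i, p i = OpenPartialHomeomorph.refl X)

/-- The tree of the reduced words that are defined at `x`, for a family of partial homeomorphisms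
that contains the identity. -/
def domainTree (x : X) : TreeSpace n where
  graph := domainGraph p x
  one_mem := by simp [mem_domainGraph]
  connected := by
    have h1 : 1 ∈ (domainGraph p x).verts := by simp [mem_domainGraph]
    refine ⟨SimpleGraph.connected_iff_exists_forall_reachable _ |>.2 ⟨⟨1, h1⟩, fun v => ?_⟩⟩
    obtain ⟨_, q, -⟩ := exists_walk_of_mem_domainGraph p v.2
    exact ⟨q⟩
  acyclic := (isAcyclic_cayleyGraph n).comap (domainGraph p x).hom
    SimpleGraph.Subgraph.hom_injective
  infinite := by
    obtain ⟨i, hi⟩ := hp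
    refine Set.infinite_of_injective_forall_mem (f := fun k : ℕ => FreeGroup.of i ^ k) ?_
      (of_pow_mem_domainGraph p hi x)
    intro k l h
    have := congrArg FreeGroup.norm h
    simpa using this

theorem mem_domainTree {x : X} {g : FreeGroup (Fin n)} :
    g ∈ (domainTree p hp x).graph.verts ↔ x ∈ (elementMap p g).source := Iff.rfl

/-- Distance from the base point is word length: `norm_le_length` gives one inequality, the walk
along the reduced word the other. -/
theorem mem_ball_domainTree {x : X} {r : ℕ} {g : FreeGroup (Fin n)} :
    g ∈ (ball (domainTree p hp x) r).verts ↔ x ∈ (elementMap p g).source ∧ g.norm ≤ r := by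
  constructor
  · rintro ⟨hg, hd⟩
    refine ⟨hg, ?_⟩
    obtain ⟨q, hq⟩ := (domainTree p hp x).connected.coe.exists_walk_length_eq_dist
      ⟨1, (domainTree p hp x).one_mem⟩ ⟨g, hg⟩
    have := norm_le_length q
    rw [FreeGroup.norm_one, zero_add, hq] at this
    exact this.trans hd
  · rintro ⟨hg, hr⟩
    obtain ⟨h1, q, hq⟩ := exists_walk_of_mem_domainGraph p hg
    exact ⟨hg, (SimpleGraph.dist_le q).trans (hq.le.trans hr)⟩

theorem ball_domainTree_eq {x y : X} {r : ℕ}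
    (h : ∀ g : FreeGroup (Fin n), g.norm ≤ r →
      (x ∈ (elementMap p g).source ↔ y ∈ (elementMap p g).source)) :
    ball (domainTree p hp x) r = ball (domainTree p hp y) r := by
  have hv : ∀ g, g ∈ (ball (domainTree p hp x) r).verts ↔
      g ∈ (ball (domainTree p hp y) r).verts := by
    intro g
    rw [mem_ball_domainTree, mem_ball_domainTree]
    exact and_congr_left (h g)
  have ha : ∀ (z : X) u v, (ball (domainTree p hp z) r).Adj u v ↔
      u ∈ (ball (domainTree p hp z) r).verts ∧ v ∈ (ball (domainTree p hp z) r).verts ∧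
        (cayleyGraph n).Adj u v := fun z u v =>
    ⟨fun h => ⟨h.1, h.2.1, h.2.2.2.2⟩, fun h => ⟨h.1, h.2.1, h.1.1, h.2.1.1, h.2.2⟩⟩
  refine SimpleGraph.Subgraph.ext (Set.ext hv) ?_
  ext u v
  rw [ha, ha, hv, hv]

/-- The ball of radius `r` is decided by the finitely many words of length at most `r`, each of
which has a clopen domain. -/
theorem continuous_domainTree (hs : ∀ i, IsClosed (p i).source)
    (ht : ∀ i, IsClosed (p i).target) : Continuous (domainTree p hp) := by
  rw [continuous_iff_continuousAt]
  intro x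
  rw [ContinuousAt, Metric.tendsto_nhds]
  intro ε hε
  obtain ⟨r, hr⟩ := exists_exp_lt hε
  have h : ∀ g ∈ {g : FreeGroup (Fin n) | g.norm ≤ r}, ∀ᶠ y in nhds x,
      (y ∈ (elementMap p g).source ↔ x ∈ (elementMap p g).source) := by
    intro g _
    have hc : IsClosed (elementMap p g).source := isClosed_source_wordMap p hs ht _
    by_cases hx : x ∈ (elementMap p g).source
    · filter_upwards [(elementMap p g).open_source.mem_nhds hx] with y hy
      exact iff_of_true hy hx
    · filter_upwards [hc.isOpen_compl.mem_nhds hx] with y hy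
      exact iff_of_false hy hx
  filter_upwards [((finite_norm_le r).eventually_all).2 h] with y hy
  exact ((dist_le_exp_iff _ _ r).2 (ball_domainTree_eq p hp hy)).trans_lt hr

theorem domainTree_elementMap {x : X} {g : FreeGroup (Fin n)}
    (hg : x ∈ (elementMap p g).source) :
    domainTree p hp (elementMap p g x) = shift g (domainTree p hp x) := by
  have hg' : g ∈ (domainTree p hp x).graph.verts := hg
  change _ = shiftFun g _
  rw [shiftFun_of_mem hg']
  have hv : ∀ v, elementMap p g x ∈ (elementMap p v).source ↔
      x ∈ (elementMap p (g * v)).source := fun v => (mem_source_elementMap_mul p hg).symm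
  refine TreeSpace.ext (SimpleGraph.Subgraph.ext (Set.ext hv) ?_)
  ext u v
  change (domainGraph p (elementMap p g x)).Adj u v ↔ (domainGraph p x).Adj (g * u) (g * v)
  rw [domainGraph_adj, domainGraph_adj, hv, hv]
  simp only [cayleyGraph_adj_iff, mul_assoc, mul_right_inj]

end DomainTree

end PointedTrees

namespace TransPseudogroup

/-! ## Pseudogroups and conjugacies -/

section Basic

variable {X : Type*} [TopologicalSpace X]

/-- Equality in `OpenPartialHomeomorph` also sees values off the domain. Gluing a member with itself
shows that membership ignores them. -/
theorem mem_of_eqOn (G : TransPseudogroup X) {e f : OpenPartialHomeomorph X X}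
    (he : e ∈ G.carrier) (hs : f.source = e.source) (h : Set.EqOn f e e.source) :
    f ∈ G.carrier :=
  G.glue_mem he he (by rw [hs, Set.union_self]) h h

theorem subset_generate (S : Set (OpenPartialHomeomorph X X)) : S ⊆ (generate S).carrier :=
  fun _ he _ hG => hG he

theorem eq_of_carrier_eq {G H : TransPseudogroup X} (h : G.carrier = H.carrier) : G = H := by
  cases G; cases H; cases h; rfl

theorem wordMap_mem (G : TransPseudogroup X) {α : Type*} {p : α → OpenPartialHomeomorph X X}
    (hp : ∀ i, p i ∈ G.carrier) (L : List (α × Bool)) : wordMap p L ∈ G.carrier := by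
  induction L with
  | nil => exact G.refl_mem
  | cons a L ih =>
    obtain ⟨i, b⟩ := a
    refine G.trans_mem ?_ ih
    cases b
    · exact G.symm_mem (hp i)
    · exact hp i

theorem restrOpen_sUnion_mem (G : TransPseudogroup X) (e : OpenPartialHomeomorph X X)
    {U : Set (Set X)} (hU : U.Finite)
    (h : ∀ s ∈ U, ∃ hs : IsOpen s, e.restrOpen s hs ∈ G.carrier) :
    ∃ hs : IsOpen (⋃₀ U), e.restrOpen (⋃₀ U) hs ∈ G.carrier := by
  induction U, hU using Set.Finite.induction_on with
  | empty =>
    rw [Set.sUnion_empty]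
    -- Nothing is known about `e` here; the empty map is obtained from the identity instead.
    refine ⟨isOpen_empty, G.mem_of_eqOn (G.restr_mem isOpen_empty G.refl_mem) ?_ ?_⟩
    · simp
    · intro x hx
      simp at hx
  | @insert s U _ _ ih =>
    obtain ⟨hs, h1⟩ := h s (Set.mem_insert s U)
    obtain ⟨hU, h2⟩ := ih fun t ht => h t (Set.mem_insert_of_mem s ht)
    rw [Set.sUnion_insert]
    refine ⟨hs.union hU, G.glue_mem h1 h2 ?_ (fun _ _ => rfl) fun _ _ => rfl⟩
    simp [Set.inter_union_distrib_left]

/-- A partial homeomorphism belongs to a pseudogroup if its restrictions to the members of a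
finite open cover do. -/
theorem mem_of_finite_cover (G : TransPseudogroup X) (e : OpenPartialHomeomorph X X)
    {U : Set (Set X)} (hU : U.Finite)
    (h : ∀ s ∈ U, ∃ hs : IsOpen s, e.restrOpen s hs ∈ G.carrier) (hc : e.source ⊆ ⋃₀ U) :
    e ∈ G.carrier := by
  obtain ⟨hs, h⟩ := G.restrOpen_sUnion_mem e hU h
  refine G.mem_of_eqOn h ?_ fun _ _ => rfl
  rw [OpenPartialHomeomorph.restrOpen_source, Set.inter_eq_left.2 hc]

end Basic

/-! ### Transport of transformations along an embedding -/

section Pullback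

variable {Ω X : Type*} [TopologicalSpace X] {Φ : Ω → X}

open Classical in
/-- The map `Φ⁻¹ ∘ τ ∘ Φ`, extended by the identity. -/
noncomputable def pullbackFun (Φ : Ω → X) (τ : OpenPartialHomeomorph X X) (x : Ω) : Ω :=
  if h : ∃ y, Φ y = τ (Φ x) then h.choose else x

theorem apply_pullbackFun {τ : OpenPartialHomeomorph X X} {x : Ω}
    (h : τ (Φ x) ∈ Set.range Φ) : Φ (pullbackFun Φ τ x) = τ (Φ x) := by
  have h' : ∃ y, Φ y = τ (Φ x) := h
  rw [pullbackFun, dif_pos h']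
  exact h'.choose_spec

variable [TopologicalSpace Ω]

/-- The partial homeomorphism `Φ⁻¹ ∘ τ ∘ Φ`, for an embedding `Φ` whose image is preserved by `τ`
and its inverse. -/
noncomputable def pullback (hΦ : Topology.IsEmbedding Φ) (τ : OpenPartialHomeomorph X X)
    (h : ∀ x, Φ x ∈ τ.source → τ (Φ x) ∈ Set.range Φ)
    (h' : ∀ x, Φ x ∈ τ.target → τ.symm (Φ x) ∈ Set.range Φ) : OpenPartialHomeomorph Ω Ω where
  toFun := pullbackFun Φ τ
  invFun := pullbackFun Φ τ.symm
  source := Φ ⁻¹' τ.source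
  target := Φ ⁻¹' τ.target
  map_source' x hx := by
    rw [Set.mem_preimage, apply_pullbackFun (h x hx)]
    exact τ.map_source hx
  map_target' x hx := by
    rw [Set.mem_preimage, apply_pullbackFun (h' x hx)]
    exact τ.map_target hx
  left_inv' x hx := hΦ.injective <| by
    have hx' : Φ (pullbackFun Φ τ x) ∈ τ.target := by
      rw [apply_pullbackFun (h x hx)]
      exact τ.map_source hx
    rw [apply_pullbackFun (h' _ hx'), apply_pullbackFun (h x hx), τ.left_inv hx]
  right_inv' x hx := hΦ.injective <| by
    have hx' : Φ (pullbackFun Φ τ.symm x) ∈ τ.source := by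
      rw [apply_pullbackFun (h' x hx)]
      exact τ.map_target hx
    rw [apply_pullbackFun (h _ hx'), apply_pullbackFun (h' x hx), τ.right_inv hx]
  open_source := τ.open_source.preimage hΦ.continuous
  open_target := τ.open_target.preimage hΦ.continuous
  continuousOn_toFun := by
    rw [hΦ.continuousOn_iff]
    refine (τ.continuousOn.comp hΦ.continuous.continuousOn fun _ hx => hx).congr fun x hx => ?_
    exact apply_pullbackFun (h x hx)
  continuousOn_invFun := by
    rw [hΦ.continuousOn_iff]
    refine (τ.symm.continuousOn.comp hΦ.continuous.continuousOn fun _ hx => hx).congr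
      fun x hx => ?_
    exact apply_pullbackFun (h' x hx)

theorem intertwines_pullback (hΦ : Topology.IsEmbedding Φ) (τ : OpenPartialHomeomorph X X)
    (h : ∀ x, Φ x ∈ τ.source → τ (Φ x) ∈ Set.range Φ)
    (h' : ∀ x, Φ x ∈ τ.target → τ.symm (Φ x) ∈ Set.range Φ) :
    Intertwines Φ (pullback hΦ τ h h') τ :=
  ⟨rfl, fun x hx => apply_pullbackFun (h x hx)⟩

theorem intertwines_pullback_symm (hΦ : Topology.IsEmbedding Φ) (τ : OpenPartialHomeomorph X X)
    (h : ∀ x, Φ x ∈ τ.source → τ (Φ x) ∈ Set.range Φ)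
    (h' : ∀ x, Φ x ∈ τ.target → τ.symm (Φ x) ∈ Set.range Φ) :
    Intertwines Φ (pullback hΦ τ h h').symm τ.symm :=
  ⟨rfl, fun x hx => apply_pullbackFun (h' x hx)⟩

theorem Intertwines.trans {γ γ' : OpenPartialHomeomorph Ω Ω} {τ τ' : OpenPartialHomeomorph X X}
    (h : Intertwines Φ γ τ) (h' : Intertwines Φ γ' τ') :
    Intertwines Φ (γ.trans γ') (τ.trans τ') := by
  constructor
  · ext x
    simp only [OpenPartialHomeomorph.trans_source, Set.mem_inter_iff, Set.mem_preimage]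
    constructor
    · rintro ⟨h1, h2⟩
      rw [h'.1, Set.mem_preimage, h.2 x h1] at h2
      rw [h.1] at h1
      exact ⟨h1, h2⟩
    · rintro ⟨h1, h2⟩
      have h3 : x ∈ γ.source := by rwa [h.1]
      refine ⟨h3, ?_⟩
      rwa [h'.1, Set.mem_preimage, h.2 x h3]
  · rintro x ⟨h1, h2⟩
    exact (h'.2 _ h2).trans (congrArg τ' (h.2 x h1))

theorem Intertwines.restrOpen {γ : OpenPartialHomeomorph Ω Ω} {τ : OpenPartialHomeomorph X X}
    (h : Intertwines Φ γ τ) (hΦ : Continuous Φ) {s : Set X} (hs : IsOpen s) :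
    Intertwines Φ (γ.restrOpen (Φ ⁻¹' s) (hs.preimage hΦ)) (τ.restrOpen s hs) := by
  constructor
  · rw [OpenPartialHomeomorph.restrOpen_source, OpenPartialHomeomorph.restrOpen_source, h.1,
      Set.preimage_inter]
  · intro x hx
    exact h.2 x hx.1

theorem Intertwines.restrOpen_symm {γ : OpenPartialHomeomorph Ω Ω}
    {τ : OpenPartialHomeomorph X X} (h : Intertwines Φ γ.symm τ.symm) (hΦ : Continuous Φ)
    {s : Set X} (hs : IsOpen s) :
    Intertwines Φ (γ.restrOpen (Φ ⁻¹' s) (hs.preimage hΦ)).symm (τ.restrOpen s hs).symm := by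
  have h1 : γ.target = Φ ⁻¹' τ.target := h.1
  constructor
  · ext x
    change x ∈ γ.target ∩ γ.symm ⁻¹' (Φ ⁻¹' s) ↔ Φ x ∈ τ.target ∩ τ.symm ⁻¹' s
    rw [Set.mem_inter_iff, Set.mem_inter_iff, h1]
    refine and_congr_right fun hx => ?_
    rw [Set.mem_preimage, Set.mem_preimage, h.2 x (by rwa [h.1]), Set.mem_preimage]
  · intro x hx
    exact h.2 x hx.1

theorem Intertwines.mem_of_mem (hΦ : Function.Injective Φ) {Γ : TransPseudogroup Ω}
    {γ γ' : OpenPartialHomeomorph Ω Ω} {τ : OpenPartialHomeomorph X X}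
    (h : Intertwines Φ γ τ) (h' : Intertwines Φ γ' τ) (hγ : γ ∈ Γ.carrier) : γ' ∈ Γ.carrier := by
  have hs : γ'.source = γ.source := by rw [h.1, h'.1]
  refine Γ.mem_of_eqOn hγ hs fun x hx => hΦ ?_
  rw [h.2 x hx, h'.2 x (by rwa [hs])]

/-- The transformations whose restrictions to the image of an embedding correspond to members of
a pseudogroup form a pseudogroup. -/
def pushforward (Γ : TransPseudogroup Ω) (hΦ : Topology.IsEmbedding Φ) : TransPseudogroup X where
  -- The condition on the inverses is not automatic: `τ.symm` could take a point of the image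
  -- outside it. It gives closure under inversion.
  carrier := {τ | ∃ γ ∈ Γ.carrier, Intertwines Φ γ τ ∧ Intertwines Φ γ.symm τ.symm}
  refl_mem := ⟨_, Γ.refl_mem, ⟨rfl, fun _ _ => rfl⟩, ⟨rfl, fun _ _ => rfl⟩⟩
  trans_mem := by
    rintro τ τ' ⟨γ, hγ, h1, h2⟩ ⟨γ', hγ', h1', h2'⟩
    exact ⟨_, Γ.trans_mem hγ hγ', h1.trans h1', h2'.trans h2⟩
  symm_mem := by
    rintro τ ⟨γ, hγ, h1, h2⟩
    exact ⟨_, Γ.symm_mem hγ, h2, h1⟩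
  restr_mem := by
    rintro τ s hs ⟨γ, hγ, h1, h2⟩
    exact ⟨_, Γ.restr_mem (hs.preimage hΦ.continuous) hγ, h1.restrOpen hΦ.continuous hs,
      h2.restrOpen_symm hΦ.continuous hs⟩
  glue_mem := by
    rintro τ τ₁ τ₂ ⟨γ₁, hγ₁, h₁, h₁'⟩ ⟨γ₂, hγ₂, h₂, h₂'⟩ hs he₁ he₂
    have hr : ∀ {τ' : OpenPartialHomeomorph X X} {γ' : OpenPartialHomeomorph Ω Ω},
        Intertwines Φ γ' τ' → Set.EqOn τ τ' τ'.source → ∀ x, Φ x ∈ τ'.source →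
        τ (Φ x) = Φ (γ' x) := by
      intro τ' γ' h' he x hx
      rw [h'.2 x (by rwa [h'.1]), he hx]
    -- The preimage of `Φ x` under the glued map lies in the domain of one of the pieces, whose
    -- inverse is already known to preserve the image of `Φ`.
    have hr' : ∀ {τ' : OpenPartialHomeomorph X X} {γ' : OpenPartialHomeomorph Ω Ω},
        Intertwines Φ γ'.symm τ'.symm → Set.EqOn τ τ' τ'.source → τ'.source ⊆ τ.source →
        ∀ x, τ.symm (Φ x) ∈ τ'.source → Φ x ∈ τ.target → τ.symm (Φ x) ∈ Set.range Φ := by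
      intro τ' γ' h' he hsub x hx hxt
      have e : τ' (τ.symm (Φ x)) = Φ x := by rw [← he hx, τ.right_inv hxt]
      have hxt' : Φ x ∈ τ'.target := e ▸ τ'.map_source hx
      refine ⟨γ'.symm x, ?_⟩
      have h1 : x ∈ γ'.symm.source := by
        rw [h'.1]
        exact hxt'
      rw [h'.2 x h1]
      nth_rw 1 [← e]
      exact τ'.left_inv hx
    have h : ∀ x, Φ x ∈ τ.source → τ (Φ x) ∈ Set.range Φ := by
      intro x hx
      rw [hs] at hx
      rcases hx with hx | hx
      · exact ⟨_, (hr h₁ he₁ x hx).symm⟩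
      · exact ⟨_, (hr h₂ he₂ x hx).symm⟩
    have h' : ∀ x, Φ x ∈ τ.target → τ.symm (Φ x) ∈ Set.range Φ := by
      intro x hx
      have := τ.map_target hx
      rw [hs] at this
      rcases this with hx' | hx'
      · exact hr' h₁' he₁ (hs ▸ Set.subset_union_left) x hx' hx
      · exact hr' h₂' he₂ (hs ▸ Set.subset_union_right) x hx' hx
    have hi := intertwines_pullback hΦ τ h h'
    refine ⟨pullback hΦ τ h h', ?_, hi, intertwines_pullback_symm hΦ τ h h'⟩
    refine Γ.glue_mem hγ₁ hγ₂ ?_ (fun x hx => hΦ.injective ?_) fun x hx => hΦ.injective ?_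
    · rw [hi.1, hs, h₁.1, h₂.1, Set.preimage_union]
    · rw [h₁.1] at hx
      have hx' : Φ x ∈ τ.source := hs ▸ Or.inl hx
      rw [hi.2 x hx', hr h₁ he₁ x hx]
    · rw [h₂.1] at hx
      have hx' : Φ x ∈ τ.source := hs ▸ Or.inr hx
      rw [hi.2 x hx', hr h₂ he₂ x hx]

end Pullback

end TransPseudogroup

namespace PointedTrees

open TransPseudogroup

/-! ### The coding by trees as an equivariant embedding -/

section Embedding

variable {Ω : Type*} [TopologicalSpace Ω] {n : ℕ} (p : Fin n → OpenPartialHomeomorph Ω Ω)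
  (hp : ∃ i, p i = OpenPartialHomeomorph.refl Ω)

theorem intertwines_domainTree (g : FreeGroup (Fin n)) :
    Intertwines (domainTree p hp) (elementMap p g) (shift g) :=
  ⟨rfl, fun _ hx => domainTree_elementMap p hp hx⟩

theorem treePseudogroup_subset_pushforward (hΦ : Topology.IsEmbedding (domainTree p hp)) :
    (treePseudogroup n).carrier ⊆ ((generate (Set.range p)).pushforward hΦ).carrier := by
  intro τ hτ
  refine hτ _ ?_
  rintro _ ⟨g, rfl⟩
  refine ⟨elementMap p g, wordMap_mem _ (fun i => subset_generate _ (Set.mem_range_self i)) _,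
    intertwines_domainTree p hp g, ?_⟩
  have h := intertwines_domainTree p hp g⁻¹
  rw [elementMap_inv] at h
  exact h

/-- The tree records only reduced words, but these determine the domains of all words. Peel off the
first letter: by `mem_source_elementMap_mul` the hypothesis passes to the images of `x` and `y`,
hence the induction over varying points. -/
theorem forall_mem_source_wordMap_iff {x y : Ω}
    (h : ∀ g : FreeGroup (Fin n), x ∈ (elementMap p g).source ↔ y ∈ (elementMap p g).source)
    (L : List (Fin n × Bool)) : x ∈ (wordMap p L).source ↔ y ∈ (wordMap p L).source := by
  induction L generalizing x y with
  | nil => exact Iff.rfl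
  | cons a L ih =>
    have ha : elementMap p (FreeGroup.mk [a]) = cond a.2 (p a.1) (p a.1).symm := by
      obtain ⟨i, b⟩ := a
      rw [elementMap, FreeGroup.toWord_mk, FreeGroup.reduce_singleton]
      cases b
      · exact wordMap_singleton_false p i
      · exact wordMap_singleton_true p i
    rw [wordMap, ← ha, OpenPartialHomeomorph.trans_source, Set.mem_inter_iff, Set.mem_inter_iff, ← h]
    refine and_congr_right fun hx => ih fun g => ?_
    rw [← mem_source_elementMap_mul p hx, ← mem_source_elementMap_mul p ((h _).1 hx)]
    exact h _

theorem isEquivariantEmbedding_domainTree [CompactSpace Ω] (hs : ∀ i, IsClosed (p i).source)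
    (ht : ∀ i, IsClosed (p i).target)
    (hsep : ∀ x y : Ω,
      (∀ L, x ∈ (wordMap p L).source ↔ y ∈ (wordMap p L).source) → x = y) :
    IsEquivariantEmbedding (generate (Set.range p)) (treePseudogroup n) (domainTree p hp) := by
  have hinj : Function.Injective (domainTree p hp) := by
    intro x y hxy
    refine hsep x y (forall_mem_source_wordMap_iff p fun g => ?_)
    rw [← mem_domainTree p hp, hxy, mem_domainTree]
  have hΦ := (continuous_domainTree p hp hs ht).isClosedEmbedding hinj
  have key := treePseudogroup_subset_pushforward p hp hΦ.isEmbedding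
  refine ⟨hΦ, ?_, ?_, ?_⟩
  · rintro τ hτ _ ⟨x, rfl⟩ hx
    obtain ⟨γ, -, h, -⟩ := key hτ
    exact ⟨γ x, h.2 x (by rwa [h.1])⟩
  · intro τ hτ
    obtain ⟨γ, hγ, h, -⟩ := key hτ
    exact ⟨γ, hγ, h⟩
  · refine eq_of_carrier_eq (Set.Subset.antisymm ?_ ?_)
    · refine fun γ hγ => hγ _ ?_
      rintro _ ⟨i, rfl⟩
      refine subset_generate _ ⟨shift (FreeGroup.of i), subset_generate _ ⟨_, rfl⟩, ?_⟩
      have h := intertwines_domainTree p hp (FreeGroup.of i)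
      rwa [elementMap_of] at h
    · refine fun γ hγ => hγ _ ?_
      rintro γ' ⟨τ, hτ, h⟩
      -- By injectivity, any map corresponding to `τ` agrees on its domain with the one supplied by
      -- `pushforward`.
      obtain ⟨γ'', hγ'', h'', -⟩ := key hτ
      exact h''.mem_of_mem hinj h hγ''

end Embedding

end PointedTrees

namespace TransPseudogroup

/-! ## Generating systems with clopen domains -/

section Clopen

theorem IsWord.trans {X : Type*} [TopologicalSpace X] {S : Set (OpenPartialHomeomorph X X)}
    {v w : OpenPartialHomeomorph X X} (hv : IsWord S v) (hw : IsWord S w) :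
    IsWord S (v.trans w) := by
  induction hw with
  | refl => rwa [OpenPartialHomeomorph.trans_refl]
  | append _ hl ih =>
    rw [← OpenPartialHomeomorph.trans_assoc]
    exact ih.append hl
  | append_symm _ hl ih =>
    rw [← OpenPartialHomeomorph.trans_assoc]
    exact ih.append_symm hl

theorem IsWord.of_mem {X : Type*} [TopologicalSpace X] {S : Set (OpenPartialHomeomorph X X)}
    {l : OpenPartialHomeomorph X X} (hl : l ∈ S) : IsWord S l := by
  have := (IsWord.refl (Λ := S)).append hl
  rwa [OpenPartialHomeomorph.refl_trans] at this

theorem IsWord.exists_eq_wordMap {X α : Type*} [TopologicalSpace X]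
    {p : α → OpenPartialHomeomorph X X} {w : OpenPartialHomeomorph X X}
    (hw : IsWord (Set.range p) w) : ∃ L, w = wordMap p L := by
  induction hw with
  | refl => exact ⟨[], rfl⟩
  | append _ hl ih =>
    obtain ⟨L, rfl⟩ := ih
    obtain ⟨i, rfl⟩ := hl
    exact ⟨L ++ [(i, true)], by rw [wordMap_append, wordMap_singleton_true]⟩
  | append_symm _ hl ih =>
    obtain ⟨L, rfl⟩ := ih
    obtain ⟨i, rfl⟩ := hl
    exact ⟨L ++ [(i, false)], by rw [wordMap_append, wordMap_singleton_false]⟩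

/-- Words in a family of restrictions are restrictions of words. -/
theorem IsWord.exists_extension {X : Type*} [TopologicalSpace X]
    {Λ S : Set (OpenPartialHomeomorph X X)}
    (h : ∀ l ∈ Λ, ∃ s ∈ S, l.source ⊆ s.source ∧ Set.EqOn l s l.source)
    {w : OpenPartialHomeomorph X X} (hw : IsWord Λ w) :
    ∃ v, IsWord S v ∧ w.source ⊆ v.source ∧ Set.EqOn w v w.source := by
  induction hw with
  | refl => exact ⟨_, IsWord.refl, subset_rfl, fun _ _ => rfl⟩
  | @append w l _ hl ih =>
    obtain ⟨v, hv, h1, h2⟩ := ih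
    obtain ⟨s, hs, h3, h4⟩ := h l hl
    refine ⟨_, hv.append hs, ?_, ?_⟩
    · rintro x ⟨hx, hx'⟩
      refine ⟨h1 hx, ?_⟩
      rw [Set.mem_preimage]
      have e : w x = v x := h2 hx
      exact e ▸ h3 hx'
    · rintro x ⟨hx, hx'⟩
      exact (h4 hx').trans (congrArg s (h2 hx))
  | @append_symm w l _ hl ih =>
    obtain ⟨v, hv, h1, h2⟩ := ih
    obtain ⟨s, hs, h3, h4⟩ := h l hl
    -- If `s` extends `l`, then its inverse extends the inverse of `l`.
    have h5 : ∀ y ∈ l.target, y ∈ s.target ∧ l.symm y = s.symm y := by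
      intro y hy
      have h6 := l.map_target hy
      have h7 : s (l.symm y) = y := by rw [← h4 h6, l.right_inv hy]
      refine ⟨h7 ▸ s.map_source (h3 h6), ?_⟩
      nth_rw 2 [← h7]
      exact (s.left_inv (h3 h6)).symm
    refine ⟨_, hv.append_symm hs, ?_, ?_⟩
    · rintro x ⟨hx, hx'⟩
      refine ⟨h1 hx, ?_⟩
      have e : w x = v x := h2 hx
      have := (h5 _ hx').1
      rw [Set.mem_preimage]
      exact e ▸ this
    · rintro x ⟨hx, hx'⟩
      exact (h5 _ hx').2.trans (congrArg s.symm (h2 hx))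

theorem isClosed_target {X : Type*} [TopologicalSpace X] [CompactSpace X] [T2Space X]
    {e : OpenPartialHomeomorph X X} (h : IsClosed e.source) : IsClosed e.target := by
  rw [← e.image_source_eq_target]
  exact (h.isCompact.image_of_continuousOn e.continuousOn).isClosed

/-- Finitely many basic clopen subsets of `U` cover `K`. This inserts a clopen domain between the
closure of the domain of a generator and the domain of its extension. -/
theorem exists_isClopen_between {X : Type*} [TopologicalSpace X]
    (hX : TopologicalSpace.IsTopologicalBasis {U : Set X | IsClopen U}) {K U : Set X}
    (hK : IsCompact K) (hU : IsOpen U) (hKU : K ⊆ U) : ∃ C, IsClopen C ∧ K ⊆ C ∧ C ⊆ U := by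
  have h : ∀ x : K, ∃ C : Set X, IsClopen C ∧ (x : X) ∈ C ∧ C ⊆ U := fun x =>
    hX.exists_subset_of_mem_open (hKU x.2) hU
  choose C hC hxC hCU using h
  obtain ⟨t, ht⟩ := hK.elim_finite_subcover C (fun x => (hC x).isOpen)
    fun x hx => Set.mem_iUnion.2 ⟨⟨x, hx⟩, hxC _⟩
  exact ⟨_, t.finite_toSet.isClopen_biUnion fun x _ => hC x, ht,
    Set.iUnion₂_subset fun x _ => hCU x⟩

variable {Ω : Type*} [MetricSpace Ω] [CompactSpace Ω]

theorem exists_finite_isClopen_cover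
    (hΩ : TopologicalSpace.IsTopologicalBasis {U : Set Ω | IsClopen U}) {ε : ℝ} (hε : 0 < ε) :
    ∃ P : Set (Set Ω), P.Finite ∧ (∀ C ∈ P, IsClopen C) ∧ (∀ x, ∃ C ∈ P, x ∈ C) ∧
      ∀ C ∈ P, ∀ x ∈ C, ∀ y ∈ C, dist x y < ε := by
  have h : ∀ x : Ω, ∃ C : Set Ω, IsClopen C ∧ x ∈ C ∧ C ⊆ Metric.ball x (ε / 2) := fun x =>
    hΩ.exists_subset_of_mem_open (Metric.mem_ball_self (half_pos hε)) Metric.isOpen_ball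
  choose C hC hxC hball using h
  obtain ⟨t, ht⟩ := isCompact_univ.elim_finite_subcover C (fun x => (hC x).isOpen)
    fun x _ => Set.mem_iUnion.2 ⟨x, hxC x⟩
  refine ⟨C '' t, t.finite_toSet.image C, ?_, ?_, ?_⟩
  · rintro _ ⟨x, -, rfl⟩
    exact hC x
  · intro x
    obtain ⟨y, hy, hx⟩ := Set.mem_iUnion₂.1 (ht (Set.mem_univ x))
    exact ⟨_, ⟨y, hy, rfl⟩, hx⟩
  · rintro _ ⟨z, -, rfl⟩ x hx y hy
    have h1 := Metric.mem_ball.1 (hball z hx)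
    have h2 := Metric.mem_ball.1 (hball z hy)
    linarith [dist_triangle_right x y z]

/-- Finitely many members of `Γ` with clopen domains move all points into `Y`. -/
theorem exists_finite_moving
    (hΩ : TopologicalSpace.IsTopologicalBasis {U : Set Ω | IsClopen U})
    {Γ : TransPseudogroup Ω} {Y : Set Ω} (hY : IsOpen Y) (h : Γ.MeetsAllOrbits Y) :
    ∃ M : Set (OpenPartialHomeomorph Ω Ω), M.Finite ∧ M ⊆ Γ.carrier ∧
      (∀ e ∈ M, IsClosed e.source) ∧ (∀ e ∈ M, e.target ⊆ Y) ∧ ∀ x, ∃ e ∈ M, x ∈ e.source := by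
  have h' : ∀ x : Ω, ∃ e ∈ Γ.carrier, IsClosed e.source ∧ e.target ⊆ Y ∧ x ∈ e.source := by
    intro x
    obtain ⟨γ, hγ, hx, hxY⟩ := h x
    have ho : IsOpen (γ.source ∩ γ ⁻¹' Y) := γ.continuousOn.isOpen_inter_preimage γ.open_source hY
    have hm : x ∈ γ.source ∩ γ ⁻¹' Y := ⟨hx, hxY⟩
    obtain ⟨C, hC, hxC, hCY⟩ := hΩ.exists_subset_of_mem_open hm ho
    have hs : (γ.restrOpen C hC.isOpen).source = C := by
      rw [OpenPartialHomeomorph.restrOpen_source]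
      exact Set.inter_eq_right.2 fun y hy => (hCY hy).1
    refine ⟨γ.restrOpen C hC.isOpen, Γ.restr_mem hC.isOpen hγ, by rw [hs]; exact hC.isClosed, ?_,
      by rwa [hs]⟩
    rw [← OpenPartialHomeomorph.image_source_eq_target, hs]
    rintro _ ⟨y, hy, rfl⟩
    exact (hCY hy).2
  choose e he hcl htY hxe using h'
  obtain ⟨t, ht⟩ := isCompact_univ.elim_finite_subcover (fun x => (e x).source)
    (fun x => (e x).open_source) fun x _ => Set.mem_iUnion.2 ⟨x, hxe x⟩
  refine ⟨e '' t, t.finite_toSet.image e, ?_, ?_, ?_, ?_⟩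
  · rintro _ ⟨x, -, rfl⟩
    exact he x
  · rintro _ ⟨x, -, rfl⟩
    exact hcl x
  · rintro _ ⟨x, -, rfl⟩
    exact htY x
  · intro x
    obtain ⟨y, hy, hx⟩ := Set.mem_iUnion₂.1 (ht (Set.mem_univ x))
    exact ⟨_, ⟨y, hy, rfl⟩, hx⟩

/-- The elements of a compact generating system are restrictions of finitely many members of the
pseudogroup with clopen domains. -/
theorem IsCompactGeneratingSystem.exists_clopen_extensions
    (hΩ : TopologicalSpace.IsTopologicalBasis {U : Set Ω | IsClopen U})
    {Γ : TransPseudogroup Ω} {Y : Set Ω} {Λ : Set (OpenPartialHomeomorph Ω Ω)}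
    (hΛ : Γ.IsCompactGeneratingSystem Y Λ) :
    ∃ E : Set (OpenPartialHomeomorph Ω Ω), E.Finite ∧ E ⊆ Γ.carrier ∧
      (∀ e ∈ E, IsClosed e.source) ∧
      ∀ l ∈ Λ, ∃ e ∈ E, l.source ⊆ e.source ∧ Set.EqOn l e l.source := by
  have h : ∀ l ∈ Λ, ∃ e ∈ Γ.carrier, IsClosed e.source ∧ l.source ⊆ e.source ∧
      Set.EqOn l e l.source := by
    intro l hl
    obtain ⟨γ, hγ, hs, he⟩ := hΛ.extends_closure l hl
    obtain ⟨C, hC, hlC, hCγ⟩ :=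
      exists_isClopen_between hΩ isClosed_closure.isCompact γ.open_source hs
    have hs : (γ.restrOpen C hC.isOpen).source = C := by
      rw [OpenPartialHomeomorph.restrOpen_source]
      exact Set.inter_eq_right.2 hCγ
    refine ⟨γ.restrOpen C hC.isOpen, Γ.restr_mem hC.isOpen hγ, by rw [hs]; exact hC.isClosed, ?_,
      he⟩
    rw [hs]
    exact subset_closure.trans hlC
  choose! e he hcl hsub heq using h
  refine ⟨e '' Λ, hΛ.finite.image e, ?_, ?_, fun l hl => ⟨_, ⟨l, hl, rfl⟩, hsub l hl, heq l hl⟩⟩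
  · rintro _ ⟨l, hl, rfl⟩
    exact he l hl
  · rintro _ ⟨l, hl, rfl⟩
    exact hcl l hl

/-- Extensions of the elements of a compact generating system, together with maps that move all
points into `Y`, generate the pseudogroup. -/
theorem IsCompactGeneratingSystem.carrier_subset {X : Type*} [TopologicalSpace X]
    {Γ : TransPseudogroup X} {Y : Set X}
    {Λ : Set (OpenPartialHomeomorph X X)} (hΛ : Γ.IsCompactGeneratingSystem Y Λ)
    {M : Set (OpenPartialHomeomorph X X)} (hM : M.Finite) (hMΓ : M ⊆ Γ.carrier)
    (hMY : ∀ e ∈ M, e.target ⊆ Y) (hMc : ∀ x, ∃ e ∈ M, x ∈ e.source)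
    {H : TransPseudogroup X} (hMH : M ⊆ H.carrier)
    (hΛH : ∀ l ∈ Λ, ∃ e ∈ H.carrier, l.source ⊆ e.source ∧ Set.EqOn l e l.source) :
    Γ.carrier ⊆ H.carrier := by
  have hΛH' : Λ ⊆ H.carrier := by
    intro l hl
    obtain ⟨e, he, hs, heq⟩ := hΛH l hl
    have h1 : (e.restrOpen l.source l.open_source).source = l.source := by
      rw [OpenPartialHomeomorph.restrOpen_source, Set.inter_eq_right.2 hs]
    refine H.mem_of_eqOn (H.restr_mem l.open_source he) h1.symm ?_
    rw [h1]
    exact heq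
  have hred : Γ.reduced Y ⊆ H.carrier := by
    rw [← hΛ.generates]
    exact fun k hk => hk.1 H hΛH'
  intro γ hγ
  -- Where `μ` is defined at `x` and `μ'` at `γ x`, the map `γ` factors as `μ`, then a member of `Γ`
  -- with domain and range in `Y`, then the inverse of `μ'`. Finitely many pairs `μ, μ'` cover the
  -- domain of `γ`.
  refine H.mem_of_finite_cover γ
    (hM.image2 (fun μ μ' => μ.source ∩ (γ.trans μ').source) hM) ?_ ?_
  · rintro _ ⟨μ, hμ, μ', hμ', rfl⟩
    have ho : IsOpen (μ.source ∩ (γ.trans μ').source) :=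
      μ.open_source.inter (γ.trans μ').open_source
    have hk : μ.symm.trans (γ.trans μ') ∈ H.carrier := by
      refine hred ⟨Γ.trans_mem (Γ.symm_mem (hMΓ hμ)) (Γ.trans_mem hγ (hMΓ hμ')), ?_, ?_⟩
      · exact fun x hx => hMY μ hμ hx.1
      · exact fun x hx => hMY μ' hμ' hx.1.1
    refine ⟨ho, H.mem_of_eqOn
      (H.trans_mem (hMH hμ) (H.trans_mem hk (H.symm_mem (hMH hμ')))) ?_ ?_⟩
    · ext x
      simp only [OpenPartialHomeomorph.restrOpen_source, OpenPartialHomeomorph.trans_source,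
        OpenPartialHomeomorph.coe_trans, Set.mem_inter_iff, Set.mem_preimage,
        Function.comp_apply, OpenPartialHomeomorph.symm_source]
      constructor
      · rintro ⟨h1, h2, -, h3⟩
        rw [μ.left_inv h2]
        exact ⟨h2, ⟨μ.map_source h2, h1, h3⟩, μ'.map_source h3⟩
      · rintro ⟨h2, ⟨-, h1, h3⟩, -⟩
        rw [μ.left_inv h2] at h1 h3
        exact ⟨h1, h2, h1, h3⟩
    · rintro x ⟨hx, ⟨-, h1, h3⟩, -⟩
      change μ.symm (μ x) ∈ γ.source at h1
      change γ (μ.symm (μ x)) ∈ μ'.source at h3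
      change γ x = μ'.symm (μ' (γ (μ.symm (μ x))))
      rw [μ'.left_inv h3, μ.left_inv hx]
  · intro x hx
    obtain ⟨μ, hμ, h1⟩ := hMc x
    obtain ⟨μ', hμ', h2⟩ := hMc (γ x)
    exact ⟨_, ⟨μ, hμ, μ', hμ', rfl⟩, h1, hx, h2⟩

/-- An expansive pseudogroup with a compact generating system on a zero-dimensional compact space
is generated by finitely many maps with clopen domains whose words separate the points. -/
theorem IsCompactGeneratingSystem.exists_separating
    (hΩ : TopologicalSpace.IsTopologicalBasis {U : Set Ω | IsClopen U})
    {Γ : TransPseudogroup Ω} {Y : Set Ω} {Λ : Set (OpenPartialHomeomorph Ω Ω)}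
    (hΛ : Γ.IsCompactGeneratingSystem Y Λ) {ε : ℝ} (hε : 0 < ε) (hexp : IsExpansiveAlong ε Y Λ) :
    ∃ S : Set (OpenPartialHomeomorph Ω Ω), S.Finite ∧ OpenPartialHomeomorph.refl Ω ∈ S ∧
      (∀ e ∈ S, IsClosed e.source) ∧ Γ = generate S ∧
      ∀ x y, (∀ w, IsWord S w → (x ∈ w.source ↔ y ∈ w.source)) → x = y := by
  obtain ⟨P, hPf, hPc, hPx, hPd⟩ := exists_finite_isClopen_cover hΩ hε
  obtain ⟨M, hMf, hMΓ, hMc, hMY, hMx⟩ := exists_finite_moving hΩ hΛ.isOpen hΛ.meets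
  obtain ⟨E, hEf, hEΓ, hEc, hEΛ⟩ := hΛ.exists_clopen_extensions hΩ
  -- The identities of the cells add no dynamics; their domains let words detect the cell of a
  -- point.
  let I : Set (OpenPartialHomeomorph Ω Ω) :=
    {e | ∃ C, ∃ hC : IsOpen C, C ∈ P ∧ e = OpenPartialHomeomorph.ofSet C hC}
  have hIf : I.Finite := by
    refine Set.Finite.of_finite_image (f := fun e => e.source) (hPf.subset ?_) ?_
    · rintro _ ⟨_, ⟨C, hC, hCP, rfl⟩, rfl⟩
      exact hCP
    · rintro _ ⟨C, hC, hCP, rfl⟩ _ ⟨C', hC', hCP', rfl⟩ h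
      have h' : C = C' := h
      subst h'
      rfl
  have hIΓ : I ⊆ Γ.carrier := by
    rintro _ ⟨C, hC, -, rfl⟩
    refine Γ.mem_of_eqOn (Γ.restr_mem hC Γ.refl_mem) ?_ fun _ _ => rfl
    simp
  let S : Set (OpenPartialHomeomorph Ω Ω) := insert (OpenPartialHomeomorph.refl Ω) (E ∪ (M ∪ I))
  have hES : E ⊆ S := fun e he => Or.inr (Or.inl he)
  have hMS : M ⊆ S := fun e he => Or.inr (Or.inr (Or.inl he))
  have hIS : I ⊆ S := fun e he => Or.inr (Or.inr (Or.inr he))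
  refine ⟨S, (hEf.union (hMf.union hIf)).insert _, Or.inl rfl, ?_, ?_, ?_⟩
  · rintro e (rfl | he | he | ⟨C, hC, hCP, rfl⟩)
    · exact isClosed_univ
    · exact hEc e he
    · exact hMc e he
    · exact (hPc C hCP).isClosed
  · refine eq_of_carrier_eq (Set.Subset.antisymm ?_ fun γ hγ => hγ Γ ?_)
    · refine hΛ.carrier_subset hMf hMΓ hMY hMx (hMS.trans (subset_generate S)) fun l hl => ?_
      obtain ⟨e, he, h⟩ := hEΛ l hl
      exact ⟨e, subset_generate S (hES he), h⟩
    · rintro e (rfl | he | he | he)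
      · exact Γ.refl_mem
      · exact hEΓ he
      · exact hMΓ he
      · exact hIΓ he
  · have hcell : ∀ x y, (∀ w, IsWord S w → (x ∈ w.source ↔ y ∈ w.source)) → dist x y < ε := by
      intro x y h
      obtain ⟨C, hCP, hx⟩ := hPx x
      have := h _ (IsWord.of_mem (hIS ⟨C, (hPc C hCP).isOpen, hCP, rfl⟩))
      exact hPd C hCP x hx y (this.1 hx)
    -- Points that words cannot distinguish have images that words cannot distinguish, since words
    -- compose.
    have hmove : ∀ {x y}, (∀ w, IsWord S w → (x ∈ w.source ↔ y ∈ w.source)) →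
        ∀ v, IsWord S v → x ∈ v.source → y ∈ v.source →
        ∀ w, IsWord S w → (v x ∈ w.source ↔ v y ∈ w.source) := by
      intro x y h v hv hx hy w hw
      have := h _ (hv.trans hw)
      rw [OpenPartialHomeomorph.trans_source] at this
      simpa [hx, hy] using this
    have hY : ∀ x ∈ Y, ∀ y ∈ Y, (∀ w, IsWord S w → (x ∈ w.source ↔ y ∈ w.source)) → x = y := by
      intro x hx y hy h
      by_contra hne
      obtain ⟨γ, hγ, hxγ, hyγ, hd⟩ := hexp x hx y hy hne (hcell x y h)
      -- The expanding word in `Λ` is replaced by a word in the clopen extensions with the same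
      -- values at the two points; the images then still share a cell.
      obtain ⟨v, hv, hs, he⟩ := hγ.exists_extension fun l hl => by
        obtain ⟨e, he, h⟩ := hEΛ l hl
        exact ⟨e, hES he, h⟩
      rw [he hxγ, he hyγ] at hd
      exact hd.not_gt (hcell _ _ (hmove h v hv (hs hxγ) (hs hyγ)))
    intro x y h
    obtain ⟨μ, hμ, hx⟩ := hMx x
    have hw := IsWord.of_mem (hMS hμ)
    have hy := (h μ hw).1 hx
    -- Expansiveness concerns `Y` only, so both points are first brought there by the same injective
    -- `μ`.
    exact μ.injOn hx hy (hY _ (hMY μ hμ (μ.map_source hx)) _ (hMY μ hμ (μ.map_source hy))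
      (hmove h μ hw hx hy))

end Clopen

end TransPseudogroup

/-! ### Listing the generators and conclusion -/

theorem exists_range_eq_of_ncard_le {α : Type*} {S : Set α} (hS : S.Finite) (hne : S.Nonempty)
    {n : ℕ} (hn : S.ncard ≤ n) : ∃ p : Fin n → α, Set.range p = S := by
  have := hS.fintype
  have := hne.to_subtype
  have hc : Fintype.card S ≤ Fintype.card (Fin n) := by
    rw [Fintype.card_fin, ← Nat.card_eq_fintype_card]
    exact hn
  obtain ⟨f⟩ := Function.Embedding.nonempty_of_card_le hc
  refine ⟨fun i => (Function.invFun f i : S), ?_⟩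
  have := (Function.invFun_surjective f.injective).range_eq
  rw [Set.range_comp' Subtype.val, this, Set.image_univ, Subtype.range_coe]

theorem theorem2 {Ω : Type*} [MetricSpace Ω] [CompactSpace Ω]
    (hΩ : TopologicalSpace.IsTopologicalBasis {U : Set Ω | IsClopen U})
    (Γ : TransPseudogroup Ω) (Y : Set Ω) (Λ : Set (OpenPartialHomeomorph Ω Ω))
    (hΛ : Γ.IsCompactGeneratingSystem Y Λ)
    (ε : ℝ) (hε : 0 < ε) (hexp : TransPseudogroup.IsExpansiveAlong ε Y Λ) :
    ∃ N : ℕ, ∀ n : ℕ, N ≤ n → ∃ Φ : Ω → PointedTrees.TreeSpace n,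
      TransPseudogroup.IsEquivariantEmbedding Γ (PointedTrees.treePseudogroup n) Φ := by
  obtain ⟨S, hSf, hrefl, hcl, rfl, hsep⟩ := hΛ.exists_separating hΩ hε hexp
  -- The generators may be listed with repetitions, so every `n` from their number on works.
  refine ⟨S.ncard, fun n hn => ?_⟩
  obtain ⟨p, rfl⟩ := exists_range_eq_of_ncard_le hSf ⟨_, hrefl⟩ hn
  refine ⟨_, PointedTrees.isEquivariantEmbedding_domainTree p hrefl (fun i => hcl _ ⟨i, rfl⟩)
    (fun i => TransPseudogroup.isClosed_target (hcl _ ⟨i, rfl⟩)) fun x y h => hsep x y ?_⟩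
  intro w hw
  obtain ⟨L, rfl⟩ := hw.exists_eq_wordMap
  exact h L
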